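/- Let $C\subset\mathbb{P}^2=\mathbb{P}^2(\mathbb{C})$ be an algebraic curve of degree $8$ with exactly six singular points, all of type $\mathbb{E}_6$, i.e. the germ of $C$ at each of them is isomorphic to the germ of $u^3-v^4=0$ at the origin of $\mathbb{C}^2$. Let $\Phi_3\in\mathrm{PGL}(3,\mathbb{C})$ be a projective automorphism of order $3$ with $\Phi_3(C)=C$. Then: 1. No line of $\mathbb{P}^2$ consists of fixed points of $\Phi_3$. 2. The six singular points of $C$ form two orbits under the group generated by $\Phi_3$. 3. $\Phi_3$ has exactly three fixed points, and they can be numbered $P_1,P_2,P_3$ so that $P_1,P_2\in C$ and $P_3\notin C$; the lines $L_1=P_2P_3$ and $L_2=P_1P_3$ are mapped onto themselves by $\Phi_3$ and satisfy $P_1\notin L_1$, $P_2\notin L_2$; and $C$ is nonsingular at $P_1$ and $P_2$, with tangent line $L_2$ at $P_1$ and tangent line $L_1$ at $P_2$. In other words, the tangent lines of $C$ at the two fixed points on $C$ are the two fixed lines that do not contain both of these points. -/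

import Mathlib

open scoped LinearAlgebra.Projectivization Topology MatrixGroups

namespace PlaneOctic

/-- The complex projective plane. -/
abbrev P2 : Type := ℙ ℂ (Fin 3 → ℂ)

/-- The set of points of the plane curve with equation `F = 0`. For homogeneous `F`
the condition does not depend on the chosen representative of `p`. -/
def curve (F : MvPolynomial (Fin 3) ℂ) : Set P2 :=
  {p | MvPolynomial.eval p.rep F = 0}

/-- The `i`-th homogeneous coordinate, at the representative of `p`, of the gradient of `F`. -/
noncomputable def grad (F : MvPolynomial (Fin 3) ℂ) (p : P2) (i : Fin 3) : ℂ :=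
  MvPolynomial.eval p.rep (MvPolynomial.pderiv i F)

/-- The singular points of the plane curve `F = 0`. -/
def singularPoints (F : MvPolynomial (Fin 3) ℂ) : Set P2 :=
  {p | p ∈ curve F ∧ grad F p = 0}

/-- The germ at the origin of `f = 0` in `ℂ²` is isomorphic to the germ `u³ - v⁴ = 0`: after a
local biholomorphism `ψ` fixing the origin, `f` becomes a unit times `u³ - v⁴`. -/
def IsE6Germ (f : ℂ × ℂ → ℂ) : Prop :=
  ∃ ψ : OpenPartialHomeomorph (ℂ × ℂ) (ℂ × ℂ),
    0 ∈ ψ.source ∧ ψ 0 = 0 ∧ AnalyticAt ℂ ψ 0 ∧ AnalyticAt ℂ ψ.symm 0 ∧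
    ∃ h : ℂ × ℂ → ℂ, AnalyticAt ℂ h 0 ∧ h 0 ≠ 0 ∧
      ∀ᶠ w in 𝓝 (0 : ℂ × ℂ), f (ψ w) = h w * (w.1 ^ 3 - w.2 ^ 4)

/-- The plane curve `F = 0` has a singularity of type `E₆` at `p`. Here `(s, t)` are the affine
coordinates centred at `p` given by completing the representative of `p` to a basis of `ℂ³`. -/
def IsE6At (F : MvPolynomial (Fin 3) ℂ) (p : P2) : Prop :=
  ∃ a b : Fin 3 → ℂ, LinearIndependent ℂ ![p.rep, a, b] ∧
    IsE6Germ (fun w => MvPolynomial.eval (p.rep + w.1 • a + w.2 • b) F)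

/-- `F = 0` is a plane curve of degree `8` with exactly six singular points,
all of them of type `E₆`. -/
structure IsSixE6Octic (F : MvPolynomial (Fin 3) ℂ) : Prop where
  ne_zero : F ≠ 0
  homogeneous : F.IsHomogeneous 8
  card_singularPoints : (singularPoints F).ncard = 6
  isE6At : ∀ p ∈ singularPoints F, IsE6At F p

/-- `L` is a line in the projective plane. -/
def IsLine (L : Set P2) : Prop :=
  ∃ a : Fin 3 → ℂ, a ≠ 0 ∧ L = {p | ∑ i, a i * p.rep i = 0}

/-- `p` is a nonsingular point of the curve `F = 0`, and `L` is the tangent line there. -/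
def IsTangentAt (F : MvPolynomial (Fin 3) ℂ) (L : Set P2) (p : P2) : Prop :=
  p ∈ curve F ∧ grad F p ≠ 0 ∧ L = {q | ∑ i, grad F p i * q.rep i = 0}

/-- The line `L` is mapped onto itself by the projective automorphism `Φ`. -/
def IsFixedLine (Φ : PGL(Fin 3, ℂ)) (L : Set P2) : Prop :=
  IsLine L ∧ (fun p : P2 => Φ • p) '' L = L

end PlaneOctic

namespace PlaneOctic

/-! ### Evaluation, top-degree parts and linear substitution. -/

section Polynomials

open MvPolynomial

variable {σ R : Type*}

/-! `Φ` lifts to a linear map `f` whose cube is a scalar `u`. Finitely many singular points force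
`F` to be squarefree, so by the Nullstellensatz the invariance of the curve as a set gives `F ∘ f =
κ F` (`exists_eval_map_eq_mul`). In an eigenbasis of `f` this confines the monomials of `F` to one
residue class modulo 3 of a weight (`exists_expansion`).

The type `E₆` enters only through its cubic jet, the cube of a nonzero linear form. If the constant,
linear and cubic terms of `F` at a point vanish along three independent directions, the point is
singular and the linear form is zero on a basis, which is absurd (`not_forall_flat`). If exactly two
eigenvalues coincide, such a point exists at the centre or on the axis of the homology
(`not_homology`). So the eigenvalues are the three cube roots of `u`, and they can be ordered so
that `κ = μ 0 ^ 8` (`exists_ordered_eigenbasis`). At most fifteen monomials then survive. At `b 1`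
and `b 2` a single linear term is left, with nonzero coefficient by flatness: these points are
smooth, and the tangents are sides of the triangle. At `b 0` no linear term is left, so `b 0` is
singular if it lies on the curve (`vertices_of_distinct`).

Thus `b 0` is the only fixed point that can be singular. If it were, the other five singular points
would split into orbits of length three. Hence the six points form two free orbits
(`two_free_orbits`), and `b 0` is off the curve. -/

lemma eval_smul_of_isHomogeneous [CommSemiring R] [Fintype σ] {F : MvPolynomial σ R} {n : ℕ}
    (hF : F.IsHomogeneous n) (c : R) (v : σ → R) : eval (c • v) F = c ^ n * eval v F := by
  rw [eval_eq', eval_eq', Finset.mul_sum]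
  refine Finset.sum_congr rfl fun d hd => ?_
  have h : ∑ i, d i = n := by
    rw [hF.degree_eq_sum_deg_support hd, ← Finsupp.degree_apply, Finsupp.degree_eq_sum]
  simp only [Pi.smul_apply, smul_eq_mul, mul_pow, Finset.prod_mul_distrib, Finset.prod_pow_eq_pow_sum,
    h]
  ring

/-- The homogeneous component of top degree of a product is the product of those of the factors. -/
lemma homogeneousComponent_mul_of_totalDegree_le [CommSemiring R] {f g : MvPolynomial σ R} {m n : ℕ}
    (hf : f.totalDegree ≤ m) (hg : g.totalDegree ≤ n) :
    homogeneousComponent (m + n) (f * g) =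
      homogeneousComponent m f * homogeneousComponent n g := by
  classical
  ext d
  by_cases hd : d.degree = m + n
  · rw [coeff_homogeneousComponent, if_pos hd, coeff_mul, coeff_mul]
    refine Finset.sum_congr rfl fun x hx => ?_
    have hx' : x.1.degree + x.2.degree = m + n := by
      rw [← hd, ← Finset.HasAntidiagonal.mem_antidiagonal.mp hx, map_add]
    rw [coeff_homogeneousComponent, coeff_homogeneousComponent]
    -- Unless the two degrees are exactly `m` and `n`, one of them exceeds its bound and that
    -- factor's coefficient is zero.
    rcases lt_trichotomy x.1.degree m with h | h | h
    · rw [if_neg h.ne, coeff_eq_zero_of_totalDegree_lt (f := g) (d := x.2)]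
      · simp
      · rw [← Finsupp.degree_apply]; omega
    · rw [if_pos h, if_pos (by omega)]
    · rw [if_neg h.ne', coeff_eq_zero_of_totalDegree_lt (f := f) (d := x.1)]
      · simp
      · rw [← Finsupp.degree_apply]; omega
  · rw [coeff_homogeneousComponent, if_neg hd]
    exact (((homogeneousComponent_isHomogeneous m f).mul
      (homogeneousComponent_isHomogeneous n g)).coeff_eq_zero hd).symm

/-- The derivative of a polynomial along a line. -/
lemma hasDerivAt_eval_line {𝕜 : Type*} [NontriviallyNormedField 𝕜] [Fintype σ]
    (F : MvPolynomial σ 𝕜) (v w : σ → 𝕜) :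
    HasDerivAt (fun t : 𝕜 => eval (v + t • w) F) (∑ i, eval v (pderiv i F) * w i) 0 := by
  classical
  induction F using MvPolynomial.induction_on with
  | C a => simpa using hasDerivAt_const (0 : 𝕜) a
  | add p q hp hq =>
    simp only [map_add, add_mul, Finset.sum_add_distrib]
    exact hp.add hq
  | mul_X p i hp =>
    have h1 : HasDerivAt (fun t : 𝕜 => v i + t * w i) (w i) 0 := by
      simpa using ((hasDerivAt_id (0 : 𝕜)).mul_const (w i)).const_add (v i)
    have h2 := hp.mul h1
    have h3 : (fun t : 𝕜 => eval (v + t • w) (p * X i)) =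
        (fun t => eval (v + t • w) p) * fun t => v i + t * w i := by
      ext t; simp
    rw [h3]
    refine h2.congr_deriv ?_
    symm
    have h4 : ∀ j, eval v (pderiv j (p * X i)) * w j =
        eval v (pderiv j p) * w j * v i + eval v p * ((if j = i then 1 else 0) * w j) := fun j => by
      rw [Derivation.leibniz, pderiv_X]
      rcases eq_or_ne i j with rfl | h
      · simp; ring
      · simp [h, h.symm]; ring
    simp only [h4, Finset.sum_add_distrib, ← Finset.sum_mul, ← Finset.mul_sum]
    simp

/-- Substitution of a linear map in a polynomial. -/
noncomputable def linSubst (A : (Fin 3 → ℂ) →ₗ[ℂ] (Fin 3 → ℂ)) (F : MvPolynomial (Fin 3) ℂ) :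
    MvPolynomial (Fin 3) ℂ :=
  aeval (fun k => ∑ i, C (A (Pi.single i 1) k) * X i) F

lemma eval_linSubst (A : (Fin 3 → ℂ) →ₗ[ℂ] (Fin 3 → ℂ)) (F : MvPolynomial (Fin 3) ℂ)
    (v : Fin 3 → ℂ) : eval v (linSubst A F) = eval (A v) F := by
  rw [linSubst, ← coe_aeval_eq_eval, ← coe_aeval_eq_eval, RingHom.coe_coe, RingHom.coe_coe,
    ← AlgHom.comp_apply, comp_aeval]
  congr 2
  ext k
  conv_rhs => rw [LinearMap.pi_apply_eq_sum_univ A v]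
  have h : ∀ x : Fin 3, (fun j => if x = j then (1 : ℂ) else 0) = Pi.single x 1 := fun x => by
    ext j; simp [Pi.single_apply, eq_comm]
  simp [mul_comm, h]

lemma isHomogeneous_linSubst (A : (Fin 3 → ℂ) →ₗ[ℂ] (Fin 3 → ℂ)) {F : MvPolynomial (Fin 3) ℂ}
    {n : ℕ} (hF : F.IsHomogeneous n) : (linSubst A F).IsHomogeneous n := by
  have := hF.aeval (n := 1) (fun k => ∑ i, C (A (Pi.single i 1) k) * X i) fun k =>
    IsHomogeneous.sum _ _ _ fun i _ => isHomogeneous_C_mul_X _ _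
  rwa [one_mul] at this

end Polynomials

/-! ### Points of the curve, and squarefreeness from finiteness. -/

section Points

open MvPolynomial

variable {F : MvPolynomial (Fin 3) ℂ} {n : ℕ}

lemma exists_rep_mk {v : Fin 3 → ℂ} (hv : v ≠ 0) :
    ∃ c : ℂ, c ≠ 0 ∧ (Projectivization.mk ℂ v hv).rep = c • v := by
  obtain ⟨c, hc⟩ := Projectivization.exists_smul_eq_mk_rep ℂ v hv
  exact ⟨c, c.ne_zero, hc.symm⟩

lemma mk_mem_curve (hF : F.IsHomogeneous n) {v : Fin 3 → ℂ} (hv : v ≠ 0) :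
    (.mk ℂ v hv : P2) ∈ curve F ↔ eval v F = 0 := by
  obtain ⟨c, hc, h⟩ := exists_rep_mk hv
  simp [curve, h, eval_smul_of_isHomogeneous hF, hc]

lemma grad_mk (hF : F.IsHomogeneous n) {v : Fin 3 → ℂ} (hv : v ≠ 0) :
    ∃ c : ℂ, c ≠ 0 ∧ ∀ i, grad F (.mk ℂ v hv) i = c * eval v (pderiv i F) := by
  obtain ⟨c, hc, h⟩ := exists_rep_mk hv
  exact ⟨c ^ (n - 1), pow_ne_zero _ hc, fun i => by
    rw [grad, h, eval_smul_of_isHomogeneous hF.pderiv]⟩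

lemma grad_mk_eq_zero_iff (hF : F.IsHomogeneous n) {v : Fin 3 → ℂ} (hv : v ≠ 0) :
    grad F (.mk ℂ v hv) = 0 ↔ ∀ w : Fin 3 → ℂ, ∑ i, eval v (pderiv i F) * w i = 0 := by
  obtain ⟨c, hc, h⟩ := grad_mk hF hv
  constructor
  · intro h0 w
    refine Finset.sum_eq_zero fun i _ => ?_
    have := congrFun h0 i
    rw [h, Pi.zero_apply, mul_eq_zero, or_iff_right hc] at this
    rw [this, zero_mul]
  · intro h0
    ext i
    have := h0 (Pi.single i 1)
    simp only [Pi.single_apply, mul_ite, mul_one, mul_zero, Finset.sum_ite_eq', Finset.mem_univ,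
      if_true] at this
    rw [h, this, mul_zero, Pi.zero_apply]

lemma mk_mem_singularPoints (hF : F.IsHomogeneous n) {v : Fin 3 → ℂ} (hv : v ≠ 0) :
    (.mk ℂ v hv : P2) ∈ singularPoints F ↔
      eval v F = 0 ∧ ∀ w : Fin 3 → ℂ, ∑ i, eval v (pderiv i F) * w i = 0 := by
  rw [← grad_mk_eq_zero_iff hF hv, ← mk_mem_curve hF hv]
  rfl

/-- A plane curve with finitely many singular points has no multiple component. -/
lemma squarefree_of_finite_singularPoints (h0 : F ≠ 0) (hF : F.IsHomogeneous n)
    (hfin : (singularPoints F).Finite) : Squarefree F := by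
  intro A hA
  by_contra hunit
  obtain ⟨B, rfl⟩ := hA
  have hB0 : B ≠ 0 := right_ne_zero_of_mul h0
  have hA0 : A ≠ 0 := left_ne_zero_of_mul (left_ne_zero_of_mul h0)
  have hdeg : (A * A * B).totalDegree = A.totalDegree + A.totalDegree + B.totalDegree := by
    rw [totalDegree_mul_of_isDomain (mul_ne_zero hA0 hA0) hB0, totalDegree_mul_of_isDomain hA0 hA0]
  have hn := hF.totalDegree h0
  set d := A.totalDegree with hd
  have hd0 : d ≠ 0 := by
    intro h
    apply hunit
    have hAC := totalDegree_eq_zero_iff_eq_C.mp (hd ▸ h)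
    have hc : coeff 0 A ≠ 0 := by
      intro h'
      rw [h', C_0] at hAC
      exact hA0 hAC
    have := (IsUnit.mk0 _ hc).map (C : ℂ →+* MvPolynomial (Fin 3) ℂ)
    rwa [← hAC] at this
  -- A square factor of a form may be replaced by its top-degree part, so the repeated factor
  -- becomes a form of positive degree.
  set A' := homogeneousComponent d A
  set B' := homogeneousComponent B.totalDegree B
  have hF' : A * A * B = A' * A' * B' := by
    rw [← homogeneousComponent_mul_of_totalDegree_le le_rfl le_rfl,
      ← homogeneousComponent_mul_of_totalDegree_le (totalDegree_mul _ _) le_rfl,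
      ← hdeg, hn, homogeneousComponent_of_mem hF, if_pos rfl]
  have hA' : A'.IsHomogeneous d := homogeneousComponent_isHomogeneous _ _
  have hA'0 : A' ≠ 0 := by
    intro h
    rw [h] at hF'
    exact h0 (by simpa using hF')
  obtain ⟨q, hq⟩ : ∃ q, eval q A' ≠ 0 := by
    by_contra! h
    exact hA'0 (funext fun x => by simpa using h x)
  have hq0 : q ≠ 0 := by
    rintro rfl
    have := eval_smul_of_isHomogeneous hA' 0 (0 : Fin 3 → ℂ)
    simp only [zero_smul, zero_pow hd0, zero_mul] at this
    exact hq this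
  have h1 : LinearIndependent ℂ ![q] := by
    rw [linearIndependent_unique_iff]; exact hq0
  obtain ⟨a, ha⟩ := exists_linearIndependent_cons_of_lt_finrank h1 (by simp)
  obtain ⟨b, hb⟩ := exists_linearIndependent_cons_of_lt_finrank ha (by simp)
  have hind : ∀ x y z : ℂ, x • q + y • a + z • b = 0 → x = 0 ∧ y = 0 ∧ z = 0 := by
    intro x y z h
    have := Fintype.linearIndependent_iff.mp hb ![z, y, x] (by
      rw [← h, Fin.sum_univ_three]
      change z • b + y • a + x • q = _
      module)
    exact ⟨this 2, this 1, this 0⟩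
  -- Each line joining `q` to a point `a + t • b` meets `A' = 0`. Otherwise `A'` is a constant `c`
  -- along `s • q + (a + t • b)`; by homogeneity it is `r ^ d * c` at `q + r • (a + t • b)`, and `r
  -- → 0` contradicts `A'(q) ≠ 0`.
  have hroot : ∀ t : ℂ, ∃ s : ℂ, eval (s • q + (a + t • b)) A' = 0 := by
    intro t
    let P : Polynomial ℂ := aeval (fun i => Polynomial.C (q i) * Polynomial.X +
      Polynomial.C ((a + t • b) i)) A'
    have hP : ∀ s, P.eval s = eval (s • q + (a + t • b)) A' := by
      intro s
      have : (Polynomial.aeval s) P = aeval (s • q + (a + t • b)) A' := by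
        simp only [P]
        rw [← AlgHom.comp_apply, comp_aeval]
        congr 2
        ext i
        simp [mul_comm s (q i)]
      rwa [Polynomial.coe_aeval_eq_eval, aeval_eq_eval] at this
    by_contra! hne
    have hdegP : P.degree = 0 := by
      by_contra hdeg
      obtain ⟨s, hs⟩ := IsAlgClosed.exists_root P hdeg
      exact hne s (by rw [← hP]; exact hs)
    rw [Polynomial.eq_C_of_degree_eq_zero hdegP] at hP
    simp only [Polynomial.eval_C] at hP
    set c := P.coeff 0
    have key : ∀ r : ℂ, r ≠ 0 → eval (q + r • (a + t • b)) A' = r ^ d * c := by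
      intro r hr
      rw [hP r⁻¹, ← eval_smul_of_isHomogeneous hA', smul_add r (r⁻¹ • q), smul_smul,
        mul_inv_cancel₀ hr, one_smul]
    have hc1 : Filter.Tendsto (fun r : ℂ => eval (q + r • (a + t • b)) A') (𝓝[≠] 0)
        (𝓝 (eval q A')) := by
      have := (hasDerivAt_eval_line A' q (a + t • b)).continuousAt.tendsto
      simp only [zero_smul, add_zero] at this
      exact this.mono_left nhdsWithin_le_nhds
    have hc2 : Filter.Tendsto (fun r : ℂ => r ^ d * c) (𝓝[≠] 0) (𝓝 0) := by
      have : Continuous fun r : ℂ => r ^ d * c := by fun_prop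
      have := this.tendsto 0
      simp only [zero_pow hd0, zero_mul] at this
      exact this.mono_left nhdsWithin_le_nhds
    refine hq (tendsto_nhds_unique (hc1.congr' ?_) hc2)
    filter_upwards [self_mem_nhdsWithin] with r hr using key r hr
  choose s hs using hroot
  have hne : ∀ t, s t • q + (a + t • b) ≠ 0 := by
    intro t h
    have := hind (s t) 1 t (by rw [← h]; module)
    exact one_ne_zero this.2.1
  -- Distinct lines through `q` give distinct zeros of `A'`, and each is singular on `A' * A' * B' =
  -- 0`.
  refine Set.infinite_of_injective_forall_mem
    (f := fun t : ℂ => (.mk ℂ (s t • q + (a + t • b)) (hne t) : P2)) ?_ ?_ hfin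
  · intro t t' h
    obtain ⟨c, hc⟩ := (Projectivization.mk_eq_mk_iff' ℂ _ _ _ _).mp h
    have := hind (c * s t' - s t) (c - 1) (c * t' - t) (by
      rw [← sub_eq_zero] at hc
      rw [← hc]; module)
    obtain ⟨-, h2, h3⟩ := this
    rw [sub_eq_zero.mp h2, one_mul] at h3
    exact (sub_eq_zero.mp h3).symm
  · intro t
    rw [mk_mem_singularPoints hF, hF']
    simp [hs, Derivation.leibniz]

end Points

/-! ### From an invariant zero set to a semi-invariant equation. -/

section Nullstellensatz

open MvPolynomial

/-- A reduced plane curve that is mapped into itself by a linear map has an equation that is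
multiplied by a constant. -/
lemma exists_eval_map_eq_mul {F : MvPolynomial (Fin 3) ℂ} {n : ℕ} (h0 : F ≠ 0)
    (hF : F.IsHomogeneous n) (hsq : Squarefree F) (A : (Fin 3 → ℂ) →ₗ[ℂ] (Fin 3 → ℂ))
    (hA : ∀ v, eval v F = 0 → eval (A v) F = 0) :
    ∃ κ : ℂ, ∀ v, eval (A v) F = κ * eval v F := by
  have hmem : linSubst A F ∈ vanishingIdeal ℂ (zeroLocus ℂ (Ideal.span {F})) := by
    rw [mem_vanishingIdeal_iff]
    intro x hx
    have := hx F (Ideal.mem_span_singleton_self F)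
    rw [aeval_eq_eval] at this ⊢
    rw [eval_linSubst]
    exact hA x this
  rw [vanishingIdeal_zeroLocus_eq_radical,
    ((isRadical_iff_span_singleton.mp hsq.isRadical).radical), Ideal.mem_span_singleton] at hmem
  obtain ⟨K, hK⟩ := hmem
  have hKC : ∃ κ : ℂ, K = C κ := by
    by_cases hK0 : K = 0
    · exact ⟨0, by simp [hK0]⟩
    refine ⟨coeff 0 K, totalDegree_eq_zero_iff_eq_C.mp ?_⟩
    have h1 := (isHomogeneous_linSubst A hF).totalDegree_le
    rw [hK, totalDegree_mul_of_isDomain h0 hK0, hF.totalDegree h0] at h1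
    omega
  obtain ⟨κ, rfl⟩ := hKC
  refine ⟨κ, fun v => ?_⟩
  rw [← eval_linSubst, hK, map_mul, eval_C, mul_comm]

end Nullstellensatz

/-! ### The cubic jet at an `E₆` point. -/

section Jets

open MvPolynomial Filter

/-- The third order jet of an `E₆` germ is the cube of a nonzero linear form. -/
lemma IsE6Germ.exists_tendsto_cube {f : ℂ × ℂ → ℂ} (hf : IsE6Germ f) :
    ∃ ℓ : ℂ × ℂ →ₗ[ℂ] ℂ, ℓ ≠ 0 ∧
      ∀ w, Tendsto (fun t : ℂ => f (t • w) / t ^ 3) (𝓝[≠] 0) (𝓝 (ℓ w ^ 3)) := by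
  obtain ⟨ψ, hs, hψ0, hψ, hφ, h, hh, hh0, heq⟩ := hf
  have hφ0 : ψ.symm 0 = 0 := by
    have := ψ.left_inv hs
    rwa [hψ0] at this
  have ht : (0 : ℂ × ℂ) ∈ ψ.target := by
    have := ψ.map_source hs
    rwa [hψ0] at this
  obtain ⟨φ', hφ'⟩ := hφ.differentiableAt
  obtain ⟨ψ', hψ'⟩ := hψ.differentiableAt
  have hcomp : φ'.comp ψ' = ContinuousLinearMap.id ℂ (ℂ × ℂ) := by
    have h1 : HasFDerivAt (ψ.symm ∘ ψ) (φ'.comp ψ') 0 :=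
      HasFDerivAt.comp 0 (by rwa [hψ0]) hψ'
    have h2 : HasFDerivAt (ψ.symm ∘ ψ) (ContinuousLinearMap.id ℂ (ℂ × ℂ)) 0 :=
      (hasFDerivAt_id 0).congr_of_eventuallyEq (ψ.eventually_left_inverse hs)
    exact h1.unique h2
  -- The limit is `h 0` times the cube of the first coordinate of the differential of `ψ.symm`; a
  -- cube root of `h 0` absorbs the unit.
  obtain ⟨c, hc⟩ := IsAlgClosed.exists_pow_nat_eq (h 0) (n := 3) (by norm_num)
  have hc0 : c ≠ 0 := by
    rintro rfl
    exact hh0 (by rw [← hc]; simp)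
  refine ⟨c • (LinearMap.fst ℂ ℂ ℂ ∘ₗ (φ' : ℂ × ℂ →ₗ[ℂ] ℂ × ℂ)), ?_, fun w => ?_⟩
  · intro h0
    have h1 := LinearMap.congr_fun h0 (ψ' (1, 0))
    have h2 : φ' (ψ' (1, 0)) = (1, 0) := DFunLike.congr_fun hcomp (1, 0)
    simp [h2, hc0] at h1
  · have hline : HasDerivAt (fun t : ℂ => t • w) w 0 := by
      simpa using (hasDerivAt_id (0 : ℂ)).smul_const w
    have hder : HasDerivAt (fun t : ℂ => ψ.symm (t • w)) (φ' w) 0 :=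
      HasFDerivAt.comp_hasDerivAt (0 : ℂ) (by simpa using hφ') hline
    have hslope := hder.tendsto_slope_zero
    simp only [zero_add, zero_smul, hφ0, sub_zero] at hslope
    have hcont : Tendsto (fun t : ℂ => ψ.symm (t • w)) (𝓝[≠] 0) (𝓝 0) := by
      have := hder.continuousAt.tendsto
      simp only [zero_smul, hφ0] at this
      exact this.mono_left nhdsWithin_le_nhds
    have h0 : Tendsto (fun t : ℂ => t • w) (𝓝[≠] 0) (𝓝 0) := by
      have := hline.continuousAt.tendsto
      simp only [zero_smul] at this
      exact this.mono_left nhdsWithin_le_nhds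
    have hlim : Tendsto (fun t : ℂ => h (ψ.symm (t • w)) *
        ((t⁻¹ • ψ.symm (t • w)).1 ^ 3 - t * (t⁻¹ • ψ.symm (t • w)).2 ^ 4)) (𝓝[≠] 0)
        (𝓝 (h 0 * ((φ' w).1 ^ 3 - 0 * (φ' w).2 ^ 4))) := by
      refine (hh.continuousAt.tendsto.comp hcont).mul (Tendsto.sub ?_ (Tendsto.mul ?_ ?_))
      · exact ((continuous_fst.tendsto _).comp hslope).pow 3
      · exact tendsto_id.mono_left nhdsWithin_le_nhds
      · exact ((continuous_snd.tendsto _).comp hslope).pow 4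
    have hval : h 0 * ((φ' w).1 ^ 3 - 0 * (φ' w).2 ^ 4) =
        ((c • (LinearMap.fst ℂ ℂ ℂ ∘ₗ (φ' : ℂ × ℂ →ₗ[ℂ] ℂ × ℂ))) w) ^ 3 := by
      simp [← hc, mul_pow]
    rw [hval] at hlim
    refine hlim.congr' ?_
    filter_upwards [hcont.eventually heq, h0.eventually (ψ.eventually_right_inverse ht),
      self_mem_nhdsWithin] with t h1 h2 h3
    rw [h2] at h1
    have h3 : t ≠ 0 := h3
    rw [h1, Prod.smul_fst, Prod.smul_snd, smul_eq_mul, smul_eq_mul]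
    field_simp

/-- At an `E₆` point, the third order jet of the equation is the cube of a nonzero linear form. -/
lemma exists_tendsto_cube {F : MvPolynomial (Fin 3) ℂ} {n : ℕ} (hF : F.IsHomogeneous n)
    {v : Fin 3 → ℂ} (hv : v ≠ 0) (hE : IsE6At F (.mk ℂ v hv)) :
    ∃ ℓ : (Fin 3 → ℂ) →ₗ[ℂ] ℂ, ℓ ≠ 0 ∧
      ∀ w, Tendsto (fun t : ℂ => eval (v + t • w) F / t ^ 3) (𝓝[≠] 0) (𝓝 (ℓ w ^ 3)) := by
  obtain ⟨a, b, hlin, hgerm⟩ := hE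
  obtain ⟨ℓ, hℓ, hlim⟩ := hgerm.exists_tendsto_cube
  obtain ⟨c, hc, hrep⟩ := exists_rep_mk hv
  rw [hrep] at hlin hlim
  let B := basisOfLinearIndependentOfCardEqFinrank hlin (by simp)
  have hB : ∀ i, B i = ![c • v, a, b] i := fun i => by simp [B]
  have hdecomp : ∀ w, w = (c * B.coord 0 w) • v + B.coord 1 w • a + B.coord 2 w • b := by
    intro w
    conv_lhs => rw [← B.sum_repr w]
    rw [Fin.sum_univ_three, hB, hB, hB]
    simp [smul_smul, mul_comm]
  -- `c ^ n` comes from rescaling the representative, `c ^ 3` from the change of parameter `t ↦ s t`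
  -- below.
  obtain ⟨d, hd⟩ := IsAlgClosed.exists_pow_nat_eq ((c ^ n)⁻¹ * c ^ 3) (n := 3) (by norm_num)
  have hd0 : d ≠ 0 := by
    rintro rfl
    have : (c ^ n)⁻¹ * c ^ 3 ≠ 0 := by positivity
    exact this (by rw [← hd]; simp)
  refine ⟨d • ℓ ∘ₗ (B.coord 1).prod (B.coord 2), ?_, fun w => ?_⟩
  · intro h0
    apply hℓ
    refine LinearMap.ext fun w => ?_
    have := LinearMap.congr_fun h0 (w.1 • B 1 + w.2 • B 2)
    simpa [hd0] using this
  · set r := c * B.coord 0 w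
    set x := B.coord 1 w
    set y := B.coord 2 w
    have hw : w = r • v + x • a + y • b := hdecomp w
    -- The component of `w` along `v` is removed by projecting back to the affine chart; `s t` is
    -- the chart parameter of `v + t • w`.
    let s : ℂ → ℂ := fun t => c * t / (1 + t * r)
    have hu : Tendsto (fun t : ℂ => 1 + t * r) (𝓝[≠] 0) (𝓝 1) := by
      have : Continuous fun t : ℂ => 1 + t * r := by fun_prop
      have := this.tendsto 0
      simp only [zero_mul, add_zero] at this
      exact this.mono_left nhdsWithin_le_nhds
    have hune : ∀ᶠ t in 𝓝[≠] (0 : ℂ), 1 + t * r ≠ 0 := hu.eventually_ne one_ne_zero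
    have hs : Tendsto s (𝓝[≠] 0) (𝓝[≠] 0) := by
      rw [tendsto_nhdsWithin_iff]
      constructor
      · have h1 : Tendsto (fun t : ℂ => c * t) (𝓝[≠] 0) (𝓝 0) := by
          have : Continuous fun t : ℂ => c * t := by fun_prop
          have := this.tendsto 0
          simp only [mul_zero] at this
          exact this.mono_left nhdsWithin_le_nhds
        have := h1.div hu one_ne_zero
        rw [zero_div] at this
        exact this
      · filter_upwards [hune, self_mem_nhdsWithin] with t h1 h2
        exact div_ne_zero (mul_ne_zero hc h2) h1
    have h1 := (hlim (x, y)).comp hs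
    have h2 := ((hu.pow n).mul ((hu.inv₀ one_ne_zero).pow 3)).mul
      (h1.const_mul ((c ^ n)⁻¹ * c ^ 3))
    have hval : (1 : ℂ) ^ n * 1⁻¹ ^ 3 * ((c ^ n)⁻¹ * c ^ 3 * ℓ (x, y) ^ 3) =
        ((d • ℓ ∘ₗ (B.coord 1).prod (B.coord 2)) w) ^ 3 := by
      rw [← hd]
      simp [mul_pow, x, y]
    rw [hval] at h2
    refine h2.congr' ?_
    filter_upwards [hune, self_mem_nhdsWithin] with t h3 h4
    have h4 : t ≠ 0 := h4
    have hvec : c • (v + t • w) =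
        (1 + t * r) • (c • v + (s t • (x, y)).1 • a + (s t • (x, y)).2 • b) := by
      have h5 : (1 + t * r) * s t = c * t := by simp only [s]; field_simp
      rw [hw]
      simp only [Prod.smul_mk, smul_eq_mul, smul_add, smul_smul]
      rw [← mul_assoc (1 + t * r) (s t), ← mul_assoc (1 + t * r) (s t), h5]
      module
    have hev := congrArg (fun z => eval z F) hvec
    simp only [eval_smul_of_isHomogeneous hF] at hev
    have hev' : eval (v + t • w) F = (c ^ n)⁻¹ * ((1 + t * r) ^ n *
        eval (c • v + (s t • (x, y)).1 • a + (s t • (x, y)).2 • b) F) := by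
      rw [← hev]; field_simp
    rw [hev']
    simp only [Function.comp_apply]
    generalize eval (c • v + (s t • (x, y)).1 • a + (s t • (x, y)).2 • b) F = E
    simp only [s]
    field_simp

/-- The coefficients of a cubic Taylor expansion are determined by the limit. -/
lemma taylor_coeff_of_tendsto {c₀ c₁ c₂ c₃ L : ℂ} {r : ℂ → ℂ} (hr : Continuous r)
    (h : Tendsto (fun t : ℂ => (c₀ + c₁ * t + c₂ * t ^ 2 + c₃ * t ^ 3 + t ^ 4 * r t) / t ^ 3)
      (𝓝[≠] 0) (𝓝 L)) : c₀ = 0 ∧ c₁ = 0 ∧ c₂ = 0 ∧ c₃ = L := by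
  -- If `g t / t ^ (k + 1)` converges, then `g 0 = 0`. Used successively to strip off the
  -- coefficients.
  have key : ∀ (k : ℕ) (g : ℂ → ℂ), Continuous g →
      Tendsto (fun t : ℂ => g t / t ^ (k + 1)) (𝓝[≠] 0) (𝓝 L) → g 0 = 0 := by
    intro k g hg hlim
    have h1 : Tendsto (fun t : ℂ => t ^ (k + 1)) (𝓝[≠] 0) (𝓝 0) := by
      have : Continuous fun t : ℂ => t ^ (k + 1) := by fun_prop
      have := this.tendsto 0
      simp only [ne_eq, Nat.add_eq_zero_iff, one_ne_zero, and_false, not_false_eq_true,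
        zero_pow] at this
      exact this.mono_left nhdsWithin_le_nhds
    have h2 := hlim.mul h1
    rw [mul_zero] at h2
    refine tendsto_nhds_unique ((hg.tendsto 0).mono_left nhdsWithin_le_nhds) (h2.congr' ?_)
    filter_upwards [self_mem_nhdsWithin] with t ht
    have : t ≠ 0 := ht
    field_simp
  have e0 : c₀ = 0 := by
    have := key 2 _ (by fun_prop) h
    simpa using this
  have e1 : c₁ = 0 := by
    have := key 1 (fun t => c₁ + c₂ * t + c₃ * t ^ 2 + t ^ 3 * r t) (by fun_prop) (h.congr' ?_)
    · simpa using this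
    filter_upwards [self_mem_nhdsWithin] with t ht
    have : t ≠ 0 := ht
    rw [e0]; field_simp; ring
  have e2 : c₂ = 0 := by
    have := key 0 (fun t => c₂ + c₃ * t + t ^ 2 * r t) (by fun_prop) (h.congr' ?_)
    · simpa using this
    filter_upwards [self_mem_nhdsWithin] with t ht
    have : t ≠ 0 := ht
    rw [e0, e1]; field_simp; ring
  refine ⟨e0, e1, e2, ?_⟩
  have hg : Continuous fun t => c₃ + t * r t := by fun_prop
  have h1 := (hg.tendsto 0).mono_left (nhdsWithin_le_nhds (s := {0}ᶜ))
  simp only [zero_mul, add_zero] at h1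
  refine tendsto_nhds_unique h1 (h.congr' ?_)
  filter_upwards [self_mem_nhdsWithin] with t ht
  have : t ≠ 0 := ht
  rw [e0, e1, e2]; field_simp; ring

end Jets

/-! ### Monomials in an eigenbasis. -/

section Expansion

open MvPolynomial

/-- A form in three variables, written out in the coordinates of an eigenbasis of a linear map that
multiplies the form by a constant. -/
lemma exists_expansion {F : MvPolynomial (Fin 3) ℂ} {n : ℕ} (hF : F.IsHomogeneous n)
    {A : (Fin 3 → ℂ) →ₗ[ℂ] (Fin 3 → ℂ)} {b : Fin 3 → Fin 3 → ℂ} {μ : Fin 3 → ℂ}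
    (hA : ∀ i, A (b i) = μ i • b i) {κ : ℂ} (hκ : ∀ v, eval (A v) F = κ * eval v F) :
    ∃ g : ℕ → ℕ → ℂ,
      (∀ x y z : ℂ, eval (x • b 0 + y • b 1 + z • b 2) F =
        ∑ i ∈ Finset.range (n + 1), ∑ j ∈ Finset.range (n + 1 - i),
          g i j * (x ^ (n - i - j) * y ^ i * z ^ j)) ∧
      ∀ i j, i + j ≤ n → g i j ≠ 0 → μ 0 ^ (n - i - j) * μ 1 ^ i * μ 2 ^ j = κ := by
  classical
  let E : (Fin 3 → ℂ) →ₗ[ℂ] (Fin 3 → ℂ) := Fintype.linearCombination ℂ b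
  have hE : ∀ v, E v = v 0 • b 0 + v 1 • b 1 + v 2 • b 2 := fun v => by
    simp [E, Fintype.linearCombination_apply, Fin.sum_univ_three]
  let G := linSubst E F
  have hG : G.IsHomogeneous n := isHomogeneous_linSubst E hF
  let m : ℕ → ℕ → Fin 3 →₀ ℕ := fun i j => Finsupp.equivFunOnFinite.symm ![n - i - j, i, j]
  -- `H` is `G` after the diagonal substitution, written so that its coefficients can be compared
  -- with those of `C κ * G`.
  let H : MvPolynomial (Fin 3) ℂ := ∑ d ∈ G.support, monomial d (coeff d G * ∏ i, μ i ^ d i)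
  have hH : H = C κ * G := by
    refine MvPolynomial.funext fun v => ?_
    have h1 : eval v H = eval (fun i => μ i * v i) G := by
      rw [eval_eq' (fun i => μ i * v i), map_sum]
      refine Finset.sum_congr rfl fun d _ => ?_
      rw [eval_monomial, Finsupp.prod_fintype _ _ (fun i => pow_zero _)]
      simp only [mul_pow, Finset.prod_mul_distrib, mul_assoc]
    have h2 : E (fun i => μ i * v i) = A (E v) := by
      simp only [hE, map_add, map_smul, hA, smul_smul, mul_comm]
    rw [h1, eval_linSubst, h2, hκ, map_mul, eval_C, eval_linSubst]
  refine ⟨fun i j => coeff (m i j) G, fun x y z => ?_, fun i j hij hne => ?_⟩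
  · have h1 : eval (x • b 0 + y • b 1 + z • b 2) F = eval ![x, y, z] G := by
      rw [eval_linSubst, hE]; rfl
    rw [h1, eval_eq', Finset.sum_sigma']
    have hsum : ∀ d ∈ G.support, d 0 + d 1 + d 2 = n := fun d hd => by
      rw [hG.degree_eq_sum_deg_support hd, ← Finsupp.degree_apply, Finsupp.degree_eq_sum,
        Fin.sum_univ_three]
    have hm : ∀ d ∈ G.support, m (d 1) (d 2) = d := fun d hd => by
      have := hsum d hd
      ext k
      fin_cases k <;> simp [m]
      omega
    refine Finset.sum_of_injOn (fun d => ⟨d 1, d 2⟩) ?_ ?_ ?_ ?_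
    · intro d hd d' hd' h
      simp only [Sigma.mk.injEq, heq_eq_eq] at h
      rw [← hm d hd, ← hm d' hd', h.1, h.2]
    · intro d hd
      have := hsum d hd
      simp only [Finset.coe_sigma, Set.mem_sigma_iff, Finset.coe_range, Set.mem_Iio]
      omega
    · rintro ⟨i, j⟩ - hp
      by_contra hne
      refine hp ⟨m i j, mem_support_iff.mpr (left_ne_zero_of_mul hne), by simp [m]⟩
    · intro d hd
      have := hsum d hd
      simp only [hm d hd, Fin.prod_univ_three, Matrix.cons_val]
      rw [show d 0 = n - d 1 - d 2 by omega]
  · have h := congrArg (coeff (m i j)) hH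
    rw [coeff_C_mul] at h
    simp only [H, coeff_sum, coeff_monomial] at h
    rw [Finset.sum_ite_eq', if_pos (mem_support_iff.mpr hne), mul_comm κ] at h
    have := mul_left_cancel₀ hne h
    rw [← this, Fin.prod_univ_three]
    simp [m]

end Expansion

/-! ### Flat points and the local structure at fixed points. -/

section FixedPoints

open MvPolynomial

variable {F : MvPolynomial (Fin 3) ℂ} {n : ℕ}

/-- The differential of a polynomial at a point. -/
noncomputable def gradForm (F : MvPolynomial (Fin 3) ℂ) (v : Fin 3 → ℂ) : (Fin 3 → ℂ) →ₗ[ℂ] ℂ :=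
  ∑ i, eval v (pderiv i F) • LinearMap.proj i

lemma gradForm_apply (F : MvPolynomial (Fin 3) ℂ) (v w : Fin 3 → ℂ) :
    gradForm F v w = ∑ i, eval v (pderiv i F) * w i := by
  simp [gradForm]

lemma gradForm_eq_of_expansion {v w : Fin 3 → ℂ} {c₀ c₁ : ℂ} {s : ℂ → ℂ} (hs : Differentiable ℂ s)
    (h : ∀ t : ℂ, eval (v + t • w) F = c₀ + c₁ * t + t ^ 2 * s t) : gradForm F v w = c₁ := by
  have h1 := hasDerivAt_eval_line F v w
  rw [← gradForm_apply, funext h] at h1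
  have h2 : HasDerivAt (fun t : ℂ => c₀ + c₁ * t + t ^ 2 * s t) c₁ 0 := by
    have h3 := (((hasDerivAt_id (0 : ℂ)).const_mul c₁).const_add c₀).add
      (((hasDerivAt_id (0 : ℂ)).pow 2).mul (hs 0).hasDerivAt)
    exact h3.congr_deriv (by simp)
  exact h1.unique h2

lemma mk_mem_singularPoints_iff_gradForm (hF : F.IsHomogeneous n) {v : Fin 3 → ℂ} (hv : v ≠ 0) :
    (.mk ℂ v hv : P2) ∈ singularPoints F ↔ eval v F = 0 ∧ gradForm F v = 0 := by
  simp only [mk_mem_singularPoints hF hv, LinearMap.ext_iff, gradForm_apply, LinearMap.zero_apply]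

/-- If all singular points are of type `E₆`, the equation cannot have vanishing linear and cubic
terms along three independent directions. -/
lemma not_forall_flat (hF : F.IsHomogeneous n) (hE : ∀ p ∈ singularPoints F, IsE6At F p)
    (b : Module.Basis (Fin 3) ℂ (Fin 3 → ℂ)) {v : Fin 3 → ℂ} (hv : v ≠ 0) :
    ¬ ∀ i, ∃ (c : ℂ) (r : ℂ → ℂ), Differentiable ℂ r ∧
      ∀ t : ℂ, eval (v + t • b i) F = c * t ^ 2 + t ^ 4 * r t := by
  intro h
  choose c r hr hexp using h
  have hsing : (.mk ℂ v hv : P2) ∈ singularPoints F := by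
    rw [mk_mem_singularPoints_iff_gradForm hF hv]
    refine ⟨by simpa using hexp 0 0, b.ext fun i => ?_⟩
    refine gradForm_eq_of_expansion (c₀ := 0) (c₁ := 0) (s := fun t => c i + t ^ 2 * r i t)
      (((differentiable_id.pow 2).mul (hr i)).const_add (c i)) fun t => ?_
    rw [hexp]; ring
  obtain ⟨ℓ, hℓ, hlim⟩ := exists_tendsto_cube hF hv (hE _ hsing)
  refine hℓ (b.ext fun i => ?_)
  have := hlim (b i)
  simp only [hexp] at this
  have := (taylor_coeff_of_tendsto (c₀ := 0) (c₁ := 0) (c₂ := c i) (c₃ := 0)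
    (hr i).continuous
    (by simpa using this)).2.2.2
  simpa using this.symm

/-- Either `(1, 0)` is a zero, or setting `y = 1` leaves a polynomial of degree `m` in `x`, which
has a root. -/
lemma exists_ne_zero_of_binary_form (c : ℕ → ℂ) (m : ℕ) (hm : m ≠ 0) :
    ∃ x y : ℂ, (x ≠ 0 ∨ y ≠ 0) ∧
      ∑ i ∈ Finset.range (m + 1), c i * (x ^ (m - i) * y ^ i) = 0 := by
  by_cases h0 : c 0 = 0
  · refine ⟨1, 0, Or.inl one_ne_zero, Finset.sum_eq_zero fun i _ => ?_⟩
    rcases Nat.eq_zero_or_pos i with rfl | hi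
    · simp [h0]
    · simp [hi.ne']
  · let P : Polynomial ℂ := ∑ i ∈ Finset.range (m + 1),
      Polynomial.C (c i) * Polynomial.X ^ (m - i)
    have hdeg : P.degree ≠ 0 := by
      intro h
      have h1 : P.coeff m = c 0 := by
        simp only [P, Polynomial.finsetSum_coeff, Polynomial.coeff_C_mul, Polynomial.coeff_X_pow]
        rw [Finset.sum_eq_single 0]
        · simp
        · intro i _ hi
          rw [if_neg (by omega), mul_zero]
        · simp
      rw [Polynomial.eq_C_of_degree_eq_zero h, Polynomial.coeff_C, if_neg hm] at h1
      exact h0 h1.symm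
    obtain ⟨x, hx⟩ := IsAlgClosed.exists_root P hdeg
    refine ⟨x, 1, Or.inr one_ne_zero, ?_⟩
    simpa [P, Polynomial.IsRoot, Polynomial.eval_finsetSum] using hx

lemma orderOf_div_eq_three {x y : ℂ} (hx : x ≠ 0) (hxy : x ^ 3 = y ^ 3) (hne : x ≠ y) :
    orderOf (y / x) = 3 := by
  refine orderOf_eq_prime ?_ ?_
  · rw [div_pow, ← hxy, div_self (pow_ne_zero 3 hx)]
  · rw [ne_eq, div_eq_one_iff_eq hx]
    exact hne.symm

/-- An octic whose singular points are of type `E₆` admits no homology of order three. -/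
lemma not_homology (h0 : F ≠ 0) (hF : F.IsHomogeneous 8)
    (hE : ∀ p ∈ singularPoints F, IsE6At F p)
    {A : (Fin 3 → ℂ) →ₗ[ℂ] (Fin 3 → ℂ)} (b : Module.Basis (Fin 3) ℂ (Fin 3 → ℂ)) {μ : Fin 3 → ℂ}
    (hA : ∀ i, A (b i) = μ i • b i) {κ : ℂ} (hκ : ∀ v, eval (A v) F = κ * eval v F)
    (hμ0 : μ 0 ≠ 0) (h01 : μ 1 = μ 0) (h02 : μ 0 ≠ μ 2) (h3 : μ 0 ^ 3 = μ 2 ^ 3) : False := by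
  obtain ⟨g, hg, hgκ⟩ := exists_expansion hF hA hκ
  have hord := orderOf_div_eq_three hμ0 h3 h02
  have hgκ' : ∀ i j, i + j ≤ 8 → g i j ≠ 0 → μ 0 ^ 8 * (μ 2 / μ 0) ^ j = κ := by
    intro i j hij hne
    rw [← hgκ i j hij hne, h01, ← pow_add, Nat.sub_sub, show 8 - (i + j) + i = 8 - j by omega,
      div_pow, pow_sub₀ _ hμ0 (by omega)]
    ring
  obtain ⟨i₀, j₀, hij, hne⟩ : ∃ i j, i + j ≤ 8 ∧ g i j ≠ 0 := by
    by_contra! hcon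
    refine h0 (MvPolynomial.funext fun v => ?_)
    rw [congrArg (fun w => eval w F) (b.sum_repr v).symm, Fin.sum_univ_three, hg,
      map_zero (eval v)]
    refine Finset.sum_eq_zero fun i hi => Finset.sum_eq_zero fun j hj => ?_
    simp only [Finset.mem_range] at hi hj
    rw [hcon i j (by omega), zero_mul]
  -- The weight depends only on `j` modulo 3, as `μ 2 / μ 0` has order three.
  have hz : ∀ i j, i + j ≤ 8 → j % 3 ≠ j₀ % 3 → g i j = 0 := by
    intro i j h hmod
    by_contra hne'
    have := (hgκ' i j h hne').trans (hgκ' i₀ j₀ hij hne).symm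
    have := mul_left_cancel₀ (pow_ne_zero 8 hμ0) this
    rw [← pow_mod_orderOf, ← pow_mod_orderOf _ j₀, hord] at this
    exact hmod ((IsPrimitiveRoot.iff_orderOf.mpr hord).pow_inj (Nat.mod_lt _ (by norm_num))
      (Nat.mod_lt _ (by norm_num)) this)
  -- If only exponents of `z` divisible by 3 occur, the centre `b 2` is flat, since 8, 7 and 5 are
  -- not among them.
  by_cases hj : j₀ % 3 = 0
  · have hz' : ∀ i j, i + j ≤ 8 → j % 3 ≠ 0 → g i j = 0 := by rwa [hj] at hz
    have hz8 : g 0 8 = 0 := hz' _ _ (by norm_num) (by norm_num)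
    have hz7 : g 0 7 = 0 := hz' _ _ (by norm_num) (by norm_num)
    have hz17 : g 1 7 = 0 := hz' _ _ (by norm_num) (by norm_num)
    refine not_forall_flat hF hE b (b.ne_zero 2) fun i => ?_
    fin_cases i
    · refine ⟨g 0 6, fun t => ∑ j ∈ Finset.range 5, g 0 j * t ^ (4 - j), by fun_prop, fun t => ?_⟩
      have := hg t 0 1
      rw [zero_smul, one_smul, add_zero, add_comm] at this
      refine this.trans ?_
      have hz5 : g 0 5 = 0 := hz' _ _ (by norm_num) (by norm_num)
      simp [Finset.sum_range_succ, hz8, hz7, hz5]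
      ring
    · refine ⟨g 2 6, fun t => ∑ j ∈ Finset.range 5, g (8 - j) j * t ^ (4 - j), by fun_prop,
        fun t => ?_⟩
      have := hg 0 t 1
      rw [zero_smul, one_smul, zero_add, add_comm] at this
      refine this.trans ?_
      have hz5 : g 3 5 = 0 := hz' _ _ (by norm_num) (by norm_num)
      simp [Finset.sum_range_succ, hz8, hz17, hz5]
      ring
    · refine ⟨0, 0, by fun_prop, fun t => ?_⟩
      have := hg 0 0 (1 + t)
      rw [zero_smul, zero_smul, zero_add, zero_add, add_smul, one_smul] at this
      refine this.trans ?_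
      simp [Finset.sum_range_succ, hz8]
  -- Otherwise `z` divides the form and there is no `z ^ 3` term. A zero of the coefficient of `z`,
  -- a binary form of degree 7, is a flat point on the axis.
  · have hz0 : ∀ i, i ≤ 8 → g i 0 = 0 := fun i hi => hz i 0 hi (Ne.symm hj)
    have hz3 : ∀ i, i ≤ 5 → g i 3 = 0 := fun i hi => hz i 3 (by omega) (Ne.symm hj)
    obtain ⟨x, y, hxy, hroot⟩ := exists_ne_zero_of_binary_form (fun i => g i 1) 7 (by norm_num)
    have hv : x • b 0 + y • b 1 ≠ 0 := by
      intro h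
      have := Fintype.linearIndependent_iff.mp b.linearIndependent ![x, y, 0]
        (by simpa [Fin.sum_univ_three] using h)
      exact hxy.elim (fun h => h (this 0)) (fun h => h (this 1))
    have hplane : ∀ x y : ℂ, eval (x • b 0 + y • b 1) F = 0 := by
      intro x y
      have := hg x y 0
      rw [zero_smul, add_zero] at this
      rw [this]
      refine Finset.sum_eq_zero fun i hi => Finset.sum_eq_zero fun j hj => ?_
      simp only [Finset.mem_range] at hi hj
      rcases Nat.eq_zero_or_pos j with rfl | hj'
      · rw [hz0 i (by omega), zero_mul]
      · simp [hj'.ne']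
    refine not_forall_flat hF hE b hv fun i => ?_
    fin_cases i
    · refine ⟨0, 0, by fun_prop, fun t => ?_⟩
      have := hplane (x + t) y
      rw [add_smul, add_right_comm] at this
      simpa using this
    · refine ⟨0, 0, by fun_prop, fun t => ?_⟩
      have := hplane x (y + t)
      rw [add_smul, ← add_assoc] at this
      simpa using this
    · refine ⟨∑ i ∈ Finset.range 7, g i 2 * (x ^ (6 - i) * y ^ i),
        fun t => ∑ j ∈ Finset.range 5, (∑ i ∈ Finset.range (5 - j),
          g i (4 + j) * (x ^ (4 - j - i) * y ^ i)) * t ^ j, by fun_prop, fun t => ?_⟩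
      refine (hg x y t).trans ?_
      have e1 : ∀ i ∈ Finset.range 9, ∑ j ∈ Finset.range (8 + 1 - i),
          g i j * (x ^ (8 - i - j) * y ^ i * t ^ j) = ∑ j ∈ Finset.range (8 + 1 - i),
          (if j = 0 then 0 else if j = 3 then 0 else g i j) *
            (x ^ (8 - i - j) * y ^ i * t ^ j) := by
        intro i hi
        refine Finset.sum_congr rfl fun j hj => ?_
        simp only [Finset.mem_range] at hi hj
        split_ifs with h h'
        · rw [h, hz0 i (by omega)]
        · rw [h', hz3 i (by omega)]
        · rfl
      rw [Finset.sum_congr rfl e1]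
      simp [Finset.sum_range_succ] at hroot ⊢
      linear_combination t * hroot

/-- The local structure at the vertices of the fundamental triangle of a collineation of order three
with three fixed points. -/
lemma vertices_of_distinct (hF : F.IsHomogeneous 8)
    (hE : ∀ p ∈ singularPoints F, IsE6At F p)
    {A : (Fin 3 → ℂ) →ₗ[ℂ] (Fin 3 → ℂ)} (b : Module.Basis (Fin 3) ℂ (Fin 3 → ℂ)) {μ : Fin 3 → ℂ}
    (hA : ∀ i, A (b i) = μ i • b i) {κ : ℂ} (hκ : ∀ v, eval (A v) F = κ * eval v F)
    (hμ0 : μ 0 ≠ 0) (h01 : μ 0 ≠ μ 1) (h02 : μ 0 ≠ μ 2) (h12 : μ 1 ≠ μ 2)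
    (h31 : μ 0 ^ 3 = μ 1 ^ 3) (h32 : μ 0 ^ 3 = μ 2 ^ 3) (hκ0 : κ = μ 0 ^ 8) :
    (eval (b 0) F = 0 → gradForm F (b 0) = 0) ∧
    (eval (b 1) F = 0 ∧ ∃ c : ℂ, c ≠ 0 ∧ gradForm F (b 1) = c • b.coord 2) ∧
    (eval (b 2) F = 0 ∧ ∃ c : ℂ, c ≠ 0 ∧ gradForm F (b 2) = c • b.coord 1) := by
  obtain ⟨g, hg, hgκ⟩ := exists_expansion hF hA hκ
  have hord := orderOf_div_eq_three hμ0 h31 h01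
  -- With `ω = μ 1 / μ 0`, the monomial with exponents `i` and `j` has weight `μ 0 ^ 8 * ω ^ (i + 2
  -- * j)`.
  have hsq : μ 2 / μ 0 = (μ 1 / μ 0) ^ 2 := by
    have q1 : μ 1 ^ 2 + μ 1 * μ 0 + μ 0 ^ 2 = 0 :=
      mul_left_cancel₀ (sub_ne_zero.mpr h01) (by linear_combination h31)
    have q2 : μ 2 ^ 2 + μ 2 * μ 0 + μ 0 ^ 2 = 0 :=
      mul_left_cancel₀ (sub_ne_zero.mpr h02) (by linear_combination h32)
    have q3 : μ 0 + μ 1 + μ 2 = 0 :=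
      mul_left_cancel₀ (sub_ne_zero.mpr h12) (by linear_combination q1 - q2)
    field_simp
    linear_combination μ 0 * q3 - q1
  have hz : ∀ i j, i + j ≤ 8 → ¬ 3 ∣ i + 2 * j → g i j = 0 := by
    intro i j hij h
    by_contra hne
    apply h
    rw [← hord, orderOf_dvd_iff_pow_eq_one, pow_add, pow_mul, ← hsq, div_pow, div_pow,
      div_mul_div_comm, ← pow_add, div_eq_one_iff_eq (pow_ne_zero _ hμ0)]
    have := hgκ i j hij hne
    refine mul_left_cancel₀ (pow_ne_zero (8 - i - j) hμ0) ?_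
    rw [← mul_assoc, this, hκ0, ← pow_add]
    congr 1; omega
  have hexp : ∀ x y z : ℂ, eval (x • b 0 + y • b 1 + z • b 2) F =
      g 0 0 * x ^ 8 + g 1 1 * x ^ 6 * y * z + g 3 0 * x ^ 5 * y ^ 3 + g 0 3 * x ^ 5 * z ^ 3
      + g 2 2 * x ^ 4 * y ^ 2 * z ^ 2 + g 4 1 * x ^ 3 * y ^ 4 * z + g 1 4 * x ^ 3 * y * z ^ 4
      + g 6 0 * x ^ 2 * y ^ 6 + g 3 3 * x ^ 2 * y ^ 3 * z ^ 3 + g 0 6 * x ^ 2 * z ^ 6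
      + g 5 2 * x * y ^ 5 * z ^ 2 + g 2 5 * x * y ^ 2 * z ^ 5
      + g 7 1 * y ^ 7 * z + g 4 4 * y ^ 4 * z ^ 4 + g 1 7 * y * z ^ 7 := by
    intro x y z
    rw [hg]
    have e1 : ∀ i ∈ Finset.range 9, ∑ j ∈ Finset.range (8 + 1 - i),
        g i j * (x ^ (8 - i - j) * y ^ i * z ^ j) = ∑ j ∈ Finset.range (8 + 1 - i),
        (if 3 ∣ i + 2 * j then g i j else 0) * (x ^ (8 - i - j) * y ^ i * z ^ j) := by
      intro i hi
      refine Finset.sum_congr rfl fun j hj => ?_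
      simp only [Finset.mem_range] at hi hj
      split_ifs with h
      · rfl
      · rw [hz i j (by omega) h]
    rw [Finset.sum_congr rfl e1]
    simp [Finset.sum_range_succ]
    ring
  have h00 : ∀ t : ℂ, eval (b 0 + t • b 0) F = g 0 0 * (1 + t) ^ 8 := fun t => by
    simpa [add_smul] using hexp (1 + t) 0 0
  have h01 : ∀ t : ℂ, eval (b 0 + t • b 1) F = g 0 0 + g 3 0 * t ^ 3 + g 6 0 * t ^ 6 := fun t => by
    simpa using hexp 1 t 0
  have h02 : ∀ t : ℂ, eval (b 0 + t • b 2) F = g 0 0 + g 0 3 * t ^ 3 + g 0 6 * t ^ 6 := fun t => by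
    simpa using hexp 1 0 t
  have h10 : ∀ t : ℂ, eval (b 1 + t • b 0) F = g 0 0 * t ^ 8 + g 3 0 * t ^ 5 + g 6 0 * t ^ 2 :=
    fun t => by simpa [add_comm] using hexp t 1 0
  have h11 : ∀ t : ℂ, eval (b 1 + t • b 1) F = 0 := fun t => by
    simpa [add_smul] using hexp 0 (1 + t) 0
  have h12 : ∀ t : ℂ, eval (b 1 + t • b 2) F = g 7 1 * t + g 4 4 * t ^ 4 + g 1 7 * t ^ 7 :=
    fun t => by simpa using hexp 0 1 t
  have h20 : ∀ t : ℂ, eval (b 2 + t • b 0) F = g 0 0 * t ^ 8 + g 0 3 * t ^ 5 + g 0 6 * t ^ 2 :=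
    fun t => by simpa [add_comm] using hexp t 0 1
  have h21 : ∀ t : ℂ, eval (b 2 + t • b 1) F = g 7 1 * t ^ 7 + g 4 4 * t ^ 4 + g 1 7 * t :=
    fun t => by simpa [add_comm] using hexp 0 t 1
  have h22 : ∀ t : ℂ, eval (b 2 + t • b 2) F = 0 := fun t => by
    simpa [add_smul] using hexp 0 0 (1 + t)
  refine ⟨fun h => b.ext fun i => ?_, ⟨by simpa using h11 0, g 7 1, ?_, b.ext fun i => ?_⟩,
    ⟨by simpa using h22 0, g 1 7, ?_, b.ext fun i => ?_⟩⟩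
  · have hg0 : g 0 0 = 0 := by simpa [h] using (h00 0).symm
    fin_cases i
    · exact gradForm_eq_of_expansion (c₀ := 0) (c₁ := 0) (s := 0) (by fun_prop) fun t => by
        simpa [hg0] using h00 t
    · exact gradForm_eq_of_expansion (c₀ := 0) (c₁ := 0)
        (s := fun t => g 3 0 * t + g 6 0 * t ^ 4) (by fun_prop) fun t => by
          rw [show b ⟨1, _⟩ = b 1 from rfl, h01, hg0]; ring
    · exact gradForm_eq_of_expansion (c₀ := 0) (c₁ := 0)
        (s := fun t => g 0 3 * t + g 0 6 * t ^ 4) (by fun_prop) fun t => by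
          rw [show b ⟨2, _⟩ = b 2 from rfl, h02, hg0]; ring
  -- The coefficient `g 7 1` carries the only linear term at `b 1`; without it `b 1` would be flat.
  · intro h
    refine not_forall_flat hF hE b (b.ne_zero 1) fun i => ?_
    fin_cases i
    · exact ⟨g 6 0, fun t => g 0 0 * t ^ 4 + g 3 0 * t, by fun_prop, fun t => by
        rw [show b ⟨0, _⟩ = b 0 from rfl, h10]; ring⟩
    · exact ⟨0, 0, by fun_prop, fun t => by simpa using h11 t⟩
    · exact ⟨0, fun t => g 4 4 + g 1 7 * t ^ 3, by fun_prop, fun t => by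
        rw [show b ⟨2, _⟩ = b 2 from rfl, h12, h]; ring⟩
  · fin_cases i
    · refine (gradForm_eq_of_expansion (c₀ := 0) (c₁ := 0)
        (s := fun t => g 0 0 * t ^ 6 + g 3 0 * t ^ 3 + g 6 0) (by fun_prop) fun t => ?_).trans
          (by simp)
      rw [show b ⟨0, _⟩ = b 0 from rfl, h10]; ring
    · refine (gradForm_eq_of_expansion (c₀ := 0) (c₁ := 0) (s := 0) (by fun_prop)
        fun t => ?_).trans (by simp)
      simpa using h11 t
    · refine (gradForm_eq_of_expansion (c₀ := 0) (c₁ := g 7 1)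
        (s := fun t => g 4 4 * t ^ 2 + g 1 7 * t ^ 5) (by fun_prop) fun t => ?_).trans (by simp)
      rw [show b ⟨2, _⟩ = b 2 from rfl, h12]; ring
  · intro h
    refine not_forall_flat hF hE b (b.ne_zero 2) fun i => ?_
    fin_cases i
    · exact ⟨g 0 6, fun t => g 0 0 * t ^ 4 + g 0 3 * t, by fun_prop, fun t => by
        rw [show b ⟨0, _⟩ = b 0 from rfl, h20]; ring⟩
    · exact ⟨0, fun t => g 4 4 + g 7 1 * t ^ 3, by fun_prop, fun t => by
        rw [show b ⟨1, _⟩ = b 1 from rfl, h21, h]; ring⟩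
    · exact ⟨0, 0, by fun_prop, fun t => by simpa using h22 t⟩
  · fin_cases i
    · refine (gradForm_eq_of_expansion (c₀ := 0) (c₁ := 0)
        (s := fun t => g 0 0 * t ^ 6 + g 0 3 * t ^ 3 + g 0 6) (by fun_prop) fun t => ?_).trans
          (by simp)
      rw [show b ⟨0, _⟩ = b 0 from rfl, h20]; ring
    · refine (gradForm_eq_of_expansion (c₀ := 0) (c₁ := g 1 7)
        (s := fun t => g 4 4 * t ^ 2 + g 7 1 * t ^ 5) (by fun_prop) fun t => ?_).trans (by simp)
      rw [show b ⟨1, _⟩ = b 1 from rfl, h21]; ring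
    · refine (gradForm_eq_of_expansion (c₀ := 0) (c₁ := 0) (s := 0) (by fun_prop)
        fun t => ?_).trans (by simp)
      simpa using h22 t

end FixedPoints

/-! ### Diagonalisation and cube roots. -/

section Eigenbasis

/-- `X ^ 3 - u` is separable, so `f` is semisimple and a basis can be extracted from the spanning
set of eigenvectors. -/
lemma exists_eigenbasis {f : Module.End ℂ (Fin 3 → ℂ)} {u : ℂ} (hu : u ≠ 0)
    (hf : f ^ 3 = algebraMap ℂ _ u) :
    ∃ (b : Module.Basis (Fin 3) ℂ (Fin 3 → ℂ)) (μ : Fin 3 → ℂ), ∀ i, f (b i) = μ i • b i := by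
  have hss : f.IsSemisimple := by
    refine Module.End.isSemisimple_of_squarefree_aeval_eq_zero
      (Polynomial.separable_X_pow_sub_C u (n := 3) (by norm_num) hu).squarefree ?_
    simp [hf]
  have htop := hss.iSup_eigenspace_eq_top
  let s : Set (Fin 3 → ℂ) := {v | ∃ μ : ℂ, f v = μ • v}
  have hs : ⊤ ≤ Submodule.span ℂ s := by
    rw [← htop]
    refine iSup_le fun μ v hv => Submodule.subset_span ⟨μ, Module.End.mem_eigenspace_iff.mp hv⟩
  let B := Module.Basis.ofSpan hs
  have : Fintype ((linearIndepOn_empty ℂ id).extend (Set.empty_subset s)) :=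
    FiniteDimensional.fintypeBasisIndex B
  have hcard : Fintype.card ((linearIndepOn_empty ℂ id).extend (Set.empty_subset s)) =
      Fintype.card (Fin 3) := by
    rw [← Module.finrank_eq_card_basis B]; simp
  let b := B.reindex (Fintype.equivOfCardEq hcard)
  have hb : ∀ i, ∃ μ : ℂ, f (b i) = μ • b i := by
    intro i
    have : b i ∈ s := by
      rw [Module.Basis.reindex_apply]
      exact Module.Basis.ofSpan_subset hs ⟨_, rfl⟩
    exact this
  choose μ hμ using hb
  exact ⟨b, μ, hμ⟩

/-- Three distinct cube roots exhaust the roots of `T ^ 3 - x ^ 3`; their elementary symmetric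
relations give its factorisation. -/
lemma eq_of_pow_three_eq {x y z w : ℂ} (hxy : x ≠ y) (hxz : x ≠ z) (hyz : y ≠ z)
    (h1 : x ^ 3 = y ^ 3) (h2 : x ^ 3 = z ^ 3) (h3 : x ^ 3 = w ^ 3) : w = x ∨ w = y ∨ w = z := by
  have q1 : y ^ 2 + y * x + x ^ 2 = 0 :=
    mul_left_cancel₀ (sub_ne_zero.mpr hxy) (by linear_combination h1)
  have q2 : z ^ 2 + z * x + x ^ 2 = 0 :=
    mul_left_cancel₀ (sub_ne_zero.mpr hxz) (by linear_combination h2)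
  have q3 : x + y + z = 0 :=
    mul_left_cancel₀ (sub_ne_zero.mpr hyz) (by linear_combination q1 - q2)
  have : (w - x) * ((w - y) * (w - z)) = 0 := by
    linear_combination -h3 + (-w ^ 2 + w * (x + y) - x * y) * q3 + (x - w) * q1
  simpa [sub_eq_zero] using this

end Eigenbasis

/-! ### Counting orbits of an element of order three. -/

section Orbits

open MulAction

variable {G X : Type*} [Group G] [MulAction G X] {g : G}

lemma ncard_orbit_zpowers (hg : orderOf g = 3) {p : X} (hp : g • p ≠ p) :
    (orbit (Subgroup.zpowers g) p).ncard = 3 := by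
  rw [← index_stabilizer]
  have hdvd := Subgroup.index_dvd_card (stabilizer (Subgroup.zpowers g) p)
  rw [Nat.card_zpowers, hg] at hdvd
  refine ((Nat.dvd_prime Nat.prime_three).mp hdvd).resolve_left fun h => hp ?_
  rw [Subgroup.index_eq_one] at h
  have : (⟨g, Subgroup.mem_zpowers g⟩ : Subgroup.zpowers g) ∈
      stabilizer (Subgroup.zpowers g) p := h ▸ Subgroup.mem_top _
  exact this

/-- Forward stability suffices: `g` has finite order, so its integer powers are natural powers. -/
lemma orbit_zpowers_subset (hg : orderOf g = 3) {S : Set X} (hS : ∀ p ∈ S, g • p ∈ S) {p : X}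
    (hp : p ∈ S) : orbit (Subgroup.zpowers g) p ⊆ S := by
  rintro _ ⟨⟨h, hh⟩, rfl⟩
  have hfin : IsOfFinOrder g := orderOf_pos_iff.mp (by omega)
  obtain ⟨k, rfl⟩ := hfin.mem_powers_iff_mem_zpowers.mpr hh
  change g ^ k • p ∈ S
  induction k with
  | zero => simpa
  | succ k ih =>
    rw [pow_succ', mul_smul]
    exact hS _ (ih (Subgroup.pow_mem _ (Subgroup.mem_zpowers g) k))

lemma smul_mem_sdiff_orbit {S : Set X} (hS : ∀ p ∈ S, g • p ∈ S) (q p : X)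
    (hp : p ∈ S \ orbit (Subgroup.zpowers g) q) : g • p ∈ S \ orbit (Subgroup.zpowers g) q := by
  refine ⟨hS p hp.1, fun h => hp.2 ?_⟩
  obtain ⟨k, hk⟩ := h
  refine ⟨(⟨g, Subgroup.mem_zpowers g⟩ : Subgroup.zpowers g)⁻¹ * k, ?_⟩
  change _ • q = p
  rw [mul_smul, inv_smul_eq_iff]
  exact hk

/-- `k + 1` makes `S` nonempty, and the additive conclusion is contradictory when `S` has fewer than
three points. -/
lemma exists_ncard_sdiff_orbit (hg : orderOf g = 3) {S : Set X} {k : ℕ} (hk : S.ncard = k + 1)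
    (hS : ∀ p ∈ S, g • p ∈ S) (hfix : ∀ p ∈ S, g • p ≠ p) :
    ∃ q, orbit (Subgroup.zpowers g) q ⊆ S ∧
      (S \ orbit (Subgroup.zpowers g) q).ncard + 3 = k + 1 := by
  have hfin : S.Finite := Set.finite_of_ncard_ne_zero (by omega)
  obtain ⟨q, hq⟩ : S.Nonempty := Set.nonempty_of_ncard_ne_zero (by omega)
  have hsub := orbit_zpowers_subset hg hS hq
  refine ⟨q, hsub, ?_⟩
  rw [← ncard_orbit_zpowers hg (hfix q hq), ← hk]
  exact Set.ncard_sdiff_add_ncard_of_subset hsub hfin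

/-- A set of six points that is stable under a group element of order three with at most one fixed
point in the set consists of two free orbits. -/
lemma two_free_orbits (hg : orderOf g = 3) {S : Set X} (h6 : S.ncard = 6)
    (hS : ∀ p ∈ S, g • p ∈ S) (hfix : ∀ p ∈ S, ∀ q ∈ S, g • p = p → g • q = q → p = q) :
    (∀ p ∈ S, g • p ≠ p) ∧ ∃ Q₁ Q₂ : X,
      Disjoint (orbit (Subgroup.zpowers g) Q₁) (orbit (Subgroup.zpowers g) Q₂) ∧
      S = orbit (Subgroup.zpowers g) Q₁ ∪ orbit (Subgroup.zpowers g) Q₂ := by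
  have hfree : ∀ p ∈ S, g • p ≠ p := by
    intro P hP hgP
    have h5 : (S \ {P}).ncard = 4 + 1 := by
      rw [Set.ncard_sdiff_singleton_of_mem hP, h6]
    have hS' : ∀ p ∈ S \ {P}, g • p ∈ S \ {P} := by
      rintro p ⟨hp, hpP⟩
      refine ⟨hS p hp, fun h => hpP ?_⟩
      rw [Set.mem_singleton_iff] at h ⊢
      exact smul_left_cancel g (h.trans hgP.symm)
    have hfix' : ∀ p ∈ S \ {P}, g • p ≠ p := fun p hp h => hp.2 (hfix p hp.1 P hP h hgP)
    obtain ⟨q, hq, hcard⟩ := exists_ncard_sdiff_orbit hg h5 hS' hfix'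
    -- Two points remain, too few for another free orbit.
    obtain ⟨r, hr, hcard'⟩ := exists_ncard_sdiff_orbit (k := 1) hg (by omega)
      (smul_mem_sdiff_orbit hS' q) fun p hp => hfix' p hp.1
    omega
  refine ⟨hfree, ?_⟩
  obtain ⟨q, hq, hcard⟩ := exists_ncard_sdiff_orbit (k := 5) hg h6 hS hfree
  obtain ⟨r, hr, hcard'⟩ := exists_ncard_sdiff_orbit (k := 2) hg (by omega)
    (smul_mem_sdiff_orbit hS q) fun p hp => hfree p hp.1
  have hfin : S.Finite := Set.finite_of_ncard_ne_zero (by omega)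
  have hempty : (S \ orbit (Subgroup.zpowers g) q) \ orbit (Subgroup.zpowers g) r = ∅ :=
    (Set.ncard_eq_zero hfin.sdiff.sdiff).mp (by omega)
  refine ⟨q, r, Set.disjoint_left.mpr fun x hx hx' => (hr hx').2 hx, Set.Subset.antisymm ?_ ?_⟩
  · intro x hx
    by_contra hcon
    rw [Set.mem_union, not_or] at hcon
    have : x ∈ (S \ orbit (Subgroup.zpowers g) q) \ orbit (Subgroup.zpowers g) r :=
      ⟨⟨hx, hcon.1⟩, hcon.2⟩
    rw [hempty] at this
    exact this
  · exact Set.union_subset hq (hr.trans Set.sdiff_subset)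

end Orbits

/-! ### Lines and tangents from linear forms. -/

section Lines

/-- The line in the projective plane defined by a linear form. -/
def lineOf (ℓ : (Fin 3 → ℂ) →ₗ[ℂ] ℂ) : Set P2 := {p | ℓ p.rep = 0}

lemma mk_mem_lineOf (ℓ : (Fin 3 → ℂ) →ₗ[ℂ] ℂ) {v : Fin 3 → ℂ} (hv : v ≠ 0) :
    (.mk ℂ v hv : P2) ∈ lineOf ℓ ↔ ℓ v = 0 := by
  obtain ⟨c, hc, h⟩ := exists_rep_mk hv
  simp [lineOf, h, hc]

lemma isLine_lineOf {ℓ : (Fin 3 → ℂ) →ₗ[ℂ] ℂ} (hℓ : ℓ ≠ 0) : IsLine (lineOf ℓ) := by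
  have h : ∀ w : Fin 3 → ℂ, ∑ i, ℓ (Pi.single i 1) * w i = ℓ w := by
    intro w
    conv_rhs => rw [← Finset.univ_sum_single w, map_sum]
    refine Finset.sum_congr rfl fun i _ => ?_
    rw [mul_comm, ← smul_eq_mul, ← map_smul, ← Pi.single_smul, smul_eq_mul, mul_one]
  refine ⟨fun i => ℓ (Pi.single i 1), fun h0 => hℓ (LinearMap.ext fun w => ?_), ?_⟩
  · rw [← h w]
    exact Finset.sum_eq_zero fun i _ => by rw [congrFun h0 i, Pi.zero_apply, zero_mul]
  · simp only [lineOf, h]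

lemma isTangentAt_lineOf {F : MvPolynomial (Fin 3) ℂ} {n : ℕ} (hF : F.IsHomogeneous n)
    {v : Fin 3 → ℂ} (hv : v ≠ 0) (h0 : MvPolynomial.eval v F = 0) {c : ℂ} (hc : c ≠ 0)
    {ℓ : (Fin 3 → ℂ) →ₗ[ℂ] ℂ} (hℓ : ℓ ≠ 0) (hgrad : gradForm F v = c • ℓ) :
    IsTangentAt F (lineOf ℓ) (.mk ℂ v hv) := by
  refine ⟨(mk_mem_curve hF hv).mpr h0, ?_, ?_⟩
  · rw [ne_eq, grad_mk_eq_zero_iff hF hv]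
    intro h
    refine (smul_ne_zero hc hℓ) (hgrad ▸ LinearMap.ext fun w => ?_)
    rw [gradForm_apply, h, LinearMap.zero_apply]
  · obtain ⟨d, hd, h⟩ := grad_mk hF hv
    ext q
    have : ∑ i, grad F (.mk ℂ v hv) i * q.rep i = d * (c * ℓ q.rep) := by
      rw [← smul_eq_mul c, ← LinearMap.smul_apply, ← hgrad, gradForm_apply, Finset.mul_sum]
      exact Finset.sum_congr rfl fun i _ => by rw [h, mul_assoc]
    simp only [lineOf, Set.mem_ofPred_eq, this]
    simp [hc, hd]

end Lines

/-! ### Fixed points and fixed lines of a diagonal collineation. -/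

section Collineation

open MvPolynomial

variable {F : MvPolynomial (Fin 3) ℂ} {Φ : PGL(Fin 3, ℂ)} {f : (Fin 3 → ℂ) ≃ₗ[ℂ] (Fin 3 → ℂ)}

/-- Differentiate `F ∘ f = κ F` along a line. -/
lemma gradForm_map {κ : ℂ} (hκ : ∀ v, eval (f v) F = κ * eval v F) (v w : Fin 3 → ℂ) :
    gradForm F (f v) (f w) = κ * gradForm F v w := by
  have h1 := hasDerivAt_eval_line F (f v) (f w)
  have h2 := (hasDerivAt_eval_line F v w).const_mul κ
  rw [← gradForm_apply] at h1 h2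
  refine h1.unique (h2.congr_of_eventuallyEq (Filter.Eventually.of_forall fun t => ?_))
  change eval (f v + t • f w) F = κ * eval (v + t • w) F
  rw [← hκ, map_add, map_smul]

lemma smul_mem_singularPoints {n : ℕ} (hF : F.IsHomogeneous n)
    (hact : ∀ v (hv : v ≠ 0), Φ • (.mk ℂ v hv : P2) = .mk ℂ (f v) (f.map_ne_zero_iff.mpr hv))
    {κ : ℂ} (hκ : ∀ v, eval (f v) F = κ * eval v F) (p : P2) (hp : p ∈ singularPoints F) :
    Φ • p ∈ singularPoints F := by
  induction p using Projectivization.ind with | _ v hv =>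
  rw [mk_mem_singularPoints_iff_gradForm hF] at hp
  rw [hact, mk_mem_singularPoints_iff_gradForm hF]
  refine ⟨by rw [hκ, hp.1, mul_zero], LinearMap.ext fun w => ?_⟩
  rw [← f.apply_symm_apply w, gradForm_map hκ, hp.2, LinearMap.zero_apply, mul_zero,
    LinearMap.zero_apply]

lemma smul_mk_eq_iff
    (hact : ∀ v (hv : v ≠ 0), Φ • (.mk ℂ v hv : P2) = .mk ℂ (f v) (f.map_ne_zero_iff.mpr hv))
    {v : Fin 3 → ℂ} (hv : v ≠ 0) : Φ • (.mk ℂ v hv : P2) = .mk ℂ v hv ↔ ∃ c : ℂ, f v = c • v := by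
  rw [hact, Projectivization.mk_eq_mk_iff']
  simp only [eq_comm]

variable {b : Module.Basis (Fin 3) ℂ (Fin 3 → ℂ)} {μ : Fin 3 → ℂ}

lemma coord_map (hμ : ∀ i, f (b i) = μ i • b i) (j : Fin 3) (v : Fin 3 → ℂ) :
    b.coord j (f v) = μ j * b.coord j v := by
  have : b.coord j ∘ₗ f.toLinearMap = μ j • b.coord j := b.ext fun i => by
    rcases eq_or_ne i j with rfl | h
    · simp [hμ]
    · simp [hμ, h]
  exact LinearMap.congr_fun this v

/-- With distinct eigenvalues an eigenvector is a multiple of one basis vector. -/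
lemma coord_eq_zero_of_map_eq_smul (hμ : ∀ i, f (b i) = μ i • b i) (hinj : Function.Injective μ)
    {v : Fin 3 → ℂ} {c : ℂ} (hv : f v = c • v) {i j : Fin 3} (hij : i ≠ j)
    (hi : b.coord i v ≠ 0) : b.coord j v = 0 := by
  by_contra hj
  have h : ∀ k, b.coord k v ≠ 0 → μ k = c := fun k hk => by
    have := coord_map hμ k v
    rw [hv, map_smul, smul_eq_mul] at this
    exact (mul_right_cancel₀ hk this).symm
  exact hij (hinj ((h i hi).trans (h j hj).symm))

lemma isFixedLine_lineOf_coord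
    (hact : ∀ v (hv : v ≠ 0), Φ • (.mk ℂ v hv : P2) = .mk ℂ (f v) (f.map_ne_zero_iff.mpr hv))
    (hμ : ∀ i, f (b i) = μ i • b i) (j : Fin 3) (hj : μ j ≠ 0) :
    IsFixedLine Φ (lineOf (b.coord j)) := by
  have hmem : ∀ p : P2, Φ • p ∈ lineOf (b.coord j) ↔ p ∈ lineOf (b.coord j) := by
    intro p
    induction p using Projectivization.ind with | _ v hv =>
    rw [hact, mk_mem_lineOf, mk_mem_lineOf, coord_map hμ, mul_eq_zero, or_iff_right hj]
  refine ⟨isLine_lineOf fun h => ?_, Set.Subset.antisymm ?_ fun p hp => ?_⟩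
  · simpa using LinearMap.congr_fun h (b j)
  · rintro _ ⟨p, hp, rfl⟩
    exact (hmem p).mpr hp
  · refine ⟨Φ⁻¹ • p, (hmem _).mp ?_, smul_inv_smul Φ p⟩
    rwa [smul_inv_smul]

/-- A collineation with three distinct eigenvalues does not fix a line pointwise. -/
lemma not_exists_pointwise_fixed_line
    (hact : ∀ v (hv : v ≠ 0), Φ • (.mk ℂ v hv : P2) = .mk ℂ (f v) (f.map_ne_zero_iff.mpr hv))
    (hμ : ∀ i, f (b i) = μ i • b i) (hinj : Function.Injective μ) :
    ¬ ∃ L : Set P2, IsLine L ∧ ∀ p ∈ L, Φ • p = p := by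
  rintro ⟨_, ⟨a, -, rfl⟩, hfix⟩
  let α : (Fin 3 → ℂ) →ₗ[ℂ] ℂ := ∑ i, a i • LinearMap.proj i
  have hα : {p : P2 | ∑ i, a i * p.rep i = 0} = lineOf α := by
    ext p; simp [lineOf, α]
  rw [hα] at hfix
  have key : ∀ i j : Fin 3, i ≠ j → ∀ x y : ℂ, x ≠ 0 → y ≠ 0 →
      x * α (b i) + y * α (b j) ≠ 0 := by
    intro i j hij x y hx hy h
    have hi : b.coord i (x • b i + y • b j) = x := by simp [hij.symm]
    have hj : b.coord j (x • b i + y • b j) = y := by simp [hij]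
    have hv : x • b i + y • b j ≠ 0 := fun h0 => hx (by rw [← hi, h0, map_zero])
    obtain ⟨c, hc⟩ := (smul_mk_eq_iff hact hv).mp
      (hfix _ ((mk_mem_lineOf α hv).mpr (by simpa using h)))
    exact hy (hj ▸ coord_eq_zero_of_map_eq_smul hμ hinj hc hij (hi.symm ▸ hx))
  -- The line contains `b i + b j` if both values vanish and `α (b j) • b i - α (b i) • b j` if
  -- neither does; neither point is fixed. So exactly one of each pair vanishes, impossible for
  -- three indices.
  have key' : ∀ i j : Fin 3, i ≠ j → (α (b i) = 0 ↔ ¬ α (b j) = 0) := by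
    intro i j hij
    constructor
    · intro hi hj
      exact key i j hij 1 1 one_ne_zero one_ne_zero (by rw [hi, hj]; simp)
    · intro hj
      by_contra hi
      exact key i j hij (α (b j)) (-α (b i)) hj (neg_ne_zero.mpr hi) (by ring)
  have h01 := key' 0 1 (by decide)
  have h02 := key' 0 2 (by decide)
  have h12 := key' 1 2 (by decide)
  tauto

lemma setOf_fixed_eq
    (hact : ∀ v (hv : v ≠ 0), Φ • (.mk ℂ v hv : P2) = .mk ℂ (f v) (f.map_ne_zero_iff.mpr hv))
    (hμ : ∀ i, f (b i) = μ i • b i) (hinj : Function.Injective μ) :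
    {p : P2 | Φ • p = p} =
      {.mk ℂ (b 1) (b.ne_zero 1), .mk ℂ (b 2) (b.ne_zero 2), .mk ℂ (b 0) (b.ne_zero 0)} := by
  ext p
  simp only [Set.mem_ofPred_eq, Set.mem_insert_iff, Set.mem_singleton_iff]
  constructor
  · induction p using Projectivization.ind with | _ v hv =>
    intro h
    obtain ⟨c, hc⟩ := (smul_mk_eq_iff hact hv).mp h
    obtain ⟨i, hi⟩ : ∃ i, b.coord i v ≠ 0 := by
      by_contra! h0
      exact hv ((Module.Basis.forall_coord_eq_zero_iff b).mp h0)
    have hvi : v = b.coord i v • b i := by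
      conv_lhs => rw [← b.sum_repr v]
      refine Finset.sum_eq_single i (fun j _ hj => ?_) (by simp)
      have := coord_eq_zero_of_map_eq_smul hμ hinj hc hj.symm hi
      rw [Module.Basis.coord_apply] at this
      rw [this, zero_smul]
    have hmk : (.mk ℂ v hv : P2) = .mk ℂ (b i) (b.ne_zero i) :=
      (Projectivization.mk_eq_mk_iff' ℂ _ _ _ _).mpr ⟨_, hvi.symm⟩
    rw [hmk]
    fin_cases i <;> simp
  · rintro (rfl | rfl | rfl) <;> exact (smul_mk_eq_iff hact _).mpr ⟨_, hμ _⟩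

lemma mk_basis_ne {i j : Fin 3} (h : i ≠ j) :
    (.mk ℂ (b i) (b.ne_zero i) : P2) ≠ .mk ℂ (b j) (b.ne_zero j) := by
  intro heq
  obtain ⟨c, hc⟩ := (Projectivization.mk_eq_mk_iff' ℂ _ _ _ _).mp heq
  have := congrArg (b.coord i) hc
  simp [h.symm] at this

end Collineation

/-! ### Lifting from `PGL` to linear maps. -/

section Lift

/-- A projective automorphism of order three is induced by a linear automorphism that is not a
scalar and whose cube is a scalar. -/
lemma exists_linear_lift {Φ : PGL(Fin 3, ℂ)} (hΦ : orderOf Φ = 3) :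
    ∃ f : (Fin 3 → ℂ) ≃ₗ[ℂ] (Fin 3 → ℂ),
      (∀ v (hv : v ≠ 0), Φ • (.mk ℂ v hv : P2) = .mk ℂ (f v) (f.map_ne_zero_iff.mpr hv)) ∧
      (∃ u : ℂ, u ≠ 0 ∧ (f : Module.End ℂ (Fin 3 → ℂ)) ^ 3 = algebraMap ℂ _ u) ∧
      ¬ ∃ c : ℂ, ∀ v, f v = c • v := by
  obtain ⟨N, rfl⟩ := Matrix.ProjGenLinGroup.mk_surjective Φ
  have hsmul : ∀ (M : GL (Fin 3) ℂ) (v : Fin 3 → ℂ), M • v =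
      (M : Matrix (Fin 3) (Fin 3) ℂ).mulVec v := fun _ _ => rfl
  have hscalar : ∀ (u : ℂˣ) (v : Fin 3 → ℂ),
      (Matrix.GeneralLinearGroup.scalar (Fin 3) u) • v = (u : ℂ) • v := fun u v => by
    rw [hsmul]; simp
  refine ⟨DistribMulAction.toLinearEquiv ℂ (Fin 3 → ℂ) N, fun v hv => rfl, ?_, ?_⟩
  · have h3 : Matrix.ProjGenLinGroup.mk (1 : GL (Fin 3) ℂ) = Matrix.ProjGenLinGroup.mk (N ^ 3) := by
      rw [map_pow, orderOf_dvd_iff_pow_eq_one.mp hΦ.dvd, map_one]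
    obtain ⟨u, hu⟩ := Matrix.ProjGenLinGroup.mk_eq_mk_iff.mp h3
    refine ⟨u, u.ne_zero, LinearMap.ext fun v => ?_⟩
    change N • N • N • v = (u : ℂ) • v
    rw [smul_smul, smul_smul, ← hscalar, ← one_mul (Matrix.GeneralLinearGroup.scalar (Fin 3) u), hu]
    congr 1
    exact (pow_three' N).symm
  · rintro ⟨c, hc⟩
    have hc' : ∀ v : Fin 3 → ℂ, N • v = c • v := hc
    have hc0 : c ≠ 0 := by
      rintro rfl
      have := hc' 1
      rw [zero_smul, smul_eq_zero_iff_eq] at this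
      exact one_ne_zero this
    have hN : N = Matrix.GeneralLinearGroup.scalar (Fin 3) (Units.mk0 c hc0) := by
      refine Units.ext (Matrix.ext_of_mulVec_single fun i => ?_)
      rw [← hsmul, ← hsmul, hc', hscalar, Units.val_mk0]
    rw [hN, Matrix.ProjGenLinGroup.mk_scalar, orderOf_one] at hΦ
    omega

end Lift

lemma exists_perm_of_ne {i j : Fin 3} (h : i ≠ j) :
    ∃ σ : Equiv.Perm (Fin 3), σ 0 = i ∧ σ 1 = j := by
  revert i j; decide

/-! ### Ordering the eigenvalues, and the theorem. -/

section Main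

open MvPolynomial

variable {F : MvPolynomial (Fin 3) ℂ} {f : (Fin 3 → ℂ) ≃ₗ[ℂ] (Fin 3 → ℂ)}

lemma exists_ordered_eigenbasis (h0 : F ≠ 0) (hF : F.IsHomogeneous 8)
    (hE : ∀ p ∈ singularPoints F, IsE6At F p) {u : ℂ} (hu : u ≠ 0)
    (hf : (f : Module.End ℂ (Fin 3 → ℂ)) ^ 3 = algebraMap ℂ _ u)
    (hns : ¬ ∃ c : ℂ, ∀ v, f v = c • v) {κ : ℂ} (hκ : ∀ v, eval (f v) F = κ * eval v F) :
    ∃ (b : Module.Basis (Fin 3) ℂ (Fin 3 → ℂ)) (μ : Fin 3 → ℂ), (∀ i, f (b i) = μ i • b i) ∧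
      Function.Injective μ ∧ (∀ i, μ i ^ 3 = u) ∧ κ = μ 0 ^ 8 := by
  obtain ⟨b, μ, hb⟩ := exists_eigenbasis hu hf
  have hb' : ∀ i, f (b i) = μ i • b i := hb
  have hf3 : ∀ v, f (f (f v)) = u • v := fun v => LinearMap.congr_fun hf v
  have hμ3 : ∀ i, μ i ^ 3 = u := fun i => by
    have := congrArg (b.coord i) (hf3 (b i))
    simp only [coord_map hb'] at this
    simp only [Module.Basis.coord_apply, map_smul, Module.Basis.repr_self,
      Finsupp.single_eq_same, smul_eq_mul, mul_one] at this
    rw [← this]; ring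
  have hμ0 : ∀ i, μ i ≠ 0 := fun i h => hu (by rw [← hμ3 i, h]; simp)
  have hinj : Function.Injective μ := by
    intro i j hij
    by_contra hne
    -- Two equal eigenvalues are moved to positions 0 and 1. The third differs, as `f` is not
    -- scalar.
    obtain ⟨σ, rfl, rfl⟩ := exists_perm_of_ne hne
    refine not_homology h0 hF hE (A := f.toLinearMap) (μ := μ ∘ σ) (b.reindex σ.symm)
      (fun i => by simpa using hb' (σ i)) hκ (hμ0 _) hij.symm (fun h => hns ⟨μ (σ 0), fun v => ?_⟩)
      ((hμ3 _).trans (hμ3 _).symm)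
    have hall : ∀ i, μ i = μ (σ 0) := fun i => by
      obtain ⟨k, rfl⟩ := σ.surjective i
      fin_cases k
      · rfl
      · exact hij.symm
      · exact h.symm
    have : f.toLinearMap = μ (σ 0) • LinearMap.id := b.ext fun i => by simp [hb', hall]
    exact LinearMap.congr_fun this v
  have hκ3 : κ ^ 3 = u ^ 8 := by
    obtain ⟨v, hv⟩ : ∃ v, eval v F ≠ 0 := by
      by_contra! h
      exact h0 (MvPolynomial.funext fun x => by simpa using h x)
    refine mul_right_cancel₀ hv ?_
    rw [← eval_smul_of_isHomogeneous hF, ← hf3, hκ, hκ, hκ]; ring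
  have hκ0 : κ ≠ 0 := by
    rintro rfl
    exact pow_ne_zero 8 hu (by rw [← hκ3]; simp)
  -- From `μ ^ 3 = u`, the equation `μ ^ 8 = κ` amounts to `μ = u ^ 3 / κ`, so this candidate has to
  -- be a cube root of `u`.
  have hν : (u ^ 3 / κ) ^ 3 = u := by
    rw [div_pow, hκ3]; field_simp
  obtain ⟨i, hi⟩ : ∃ i, u ^ 3 / κ = μ i := by
    rcases eq_of_pow_three_eq (hinj.ne (show (0 : Fin 3) ≠ 1 by decide))
      (hinj.ne (show (0 : Fin 3) ≠ 2 by decide)) (hinj.ne (show (1 : Fin 3) ≠ 2 by decide))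
      ((hμ3 0).trans (hμ3 1).symm) ((hμ3 0).trans (hμ3 2).symm)
      ((hμ3 0).trans hν.symm) with h | h | h
    exacts [⟨0, h⟩, ⟨1, h⟩, ⟨2, h⟩]
  obtain ⟨j, hj⟩ := exists_ne i
  obtain ⟨σ, rfl, -⟩ := exists_perm_of_ne hj.symm
  refine ⟨b.reindex σ.symm, μ ∘ σ, fun i => by simpa using hb' (σ i), hinj.comp σ.injective,
    fun i => hμ3 (σ i), ?_⟩
  have h9 : μ (σ 0) ^ 9 = u ^ 3 := by rw [← hμ3 (σ 0)]; ring
  rw [div_eq_iff hκ0, ← h9] at hi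
  refine mul_left_cancel₀ (hμ0 (σ 0)) (hi.symm.trans ?_)
  simp only [Function.comp_apply]; ring

end Main

end PlaneOctic

theorem mainTheorem6 (F : MvPolynomial (Fin 3) ℂ) (hF : PlaneOctic.IsSixE6Octic F)
    (Φ : PGL(Fin 3, ℂ)) (hΦ : orderOf Φ = 3)
    (hinv : (fun p : PlaneOctic.P2 => Φ • p) '' PlaneOctic.curve F = PlaneOctic.curve F) :
    (¬ ∃ L : Set PlaneOctic.P2, PlaneOctic.IsLine L ∧ ∀ p ∈ L, Φ • p = p) ∧
    (∃ Q₁ Q₂ : PlaneOctic.P2,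
      Disjoint (MulAction.orbit (Subgroup.zpowers Φ) Q₁)
        (MulAction.orbit (Subgroup.zpowers Φ) Q₂) ∧
      PlaneOctic.singularPoints F =
        MulAction.orbit (Subgroup.zpowers Φ) Q₁ ∪ MulAction.orbit (Subgroup.zpowers Φ) Q₂) ∧
    (∃ P₁ P₂ P₃ : PlaneOctic.P2, P₁ ≠ P₂ ∧ P₁ ≠ P₃ ∧ P₂ ≠ P₃ ∧
      {p : PlaneOctic.P2 | Φ • p = p} = {P₁, P₂, P₃} ∧
      P₁ ∈ PlaneOctic.curve F ∧ P₂ ∈ PlaneOctic.curve F ∧ P₃ ∉ PlaneOctic.curve F ∧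
      ∃ L₁ L₂ : Set PlaneOctic.P2,
        PlaneOctic.IsFixedLine Φ L₁ ∧ P₂ ∈ L₁ ∧ P₃ ∈ L₁ ∧ P₁ ∉ L₁ ∧
        PlaneOctic.IsFixedLine Φ L₂ ∧ P₁ ∈ L₂ ∧ P₃ ∈ L₂ ∧ P₂ ∉ L₂ ∧
        PlaneOctic.IsTangentAt F L₂ P₁ ∧ PlaneOctic.IsTangentAt F L₁ P₂) := by
  open PlaneOctic MvPolynomial in
  obtain ⟨h0, hhom, hcard, hE⟩ := hF
  obtain ⟨f, hact, ⟨u, hu, hf3⟩, hns⟩ := exists_linear_lift hΦ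
  have hsq := squarefree_of_finite_singularPoints h0 hhom
    (Set.finite_of_ncard_ne_zero (by omega))
  have hmaps : ∀ v, eval v F = 0 → eval (f v) F = 0 := by
    intro v hv
    by_cases hv0 : v = 0
    · rwa [hv0, map_zero, ← hv0]
    · rw [← mk_mem_curve hhom (f.map_ne_zero_iff.mpr hv0), ← hact v hv0, ← hinv]
      exact ⟨_, (mk_mem_curve hhom hv0).mpr hv, rfl⟩
  obtain ⟨κ, hκ⟩ := exists_eval_map_eq_mul h0 hhom hsq f.toLinearMap hmaps
  obtain ⟨b, μ, hμ, hinj, hμ3, hκ0⟩ := exists_ordered_eigenbasis h0 hhom hE hu hf3 hns hκ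
  have hμ0 : ∀ i, μ i ≠ 0 := fun i h => hu (by rw [← hμ3 i, h]; simp)
  obtain ⟨hP₃, ⟨e₁, c₁, hc₁, hg₁⟩, ⟨e₂, c₂, hc₂, hg₂⟩⟩ := vertices_of_distinct hhom hE b
    (A := f.toLinearMap) hμ hκ (hμ0 0) (hinj.ne (by decide)) (hinj.ne (by decide))
    (hinj.ne (by decide)) ((hμ3 0).trans (hμ3 1).symm) ((hμ3 0).trans (hμ3 2).symm) hκ0
  have hfixed := setOf_fixed_eq hact hμ hinj
  have hcoord : ∀ i, b.coord i ≠ 0 := fun i h => by simpa using LinearMap.congr_fun h (b i)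
  have hns₁ : (.mk ℂ (b 1) (b.ne_zero 1) : P2) ∉ singularPoints F := fun h =>
    smul_ne_zero hc₁ (hcoord 2)
      (hg₁ ▸ ((mk_mem_singularPoints_iff_gradForm hhom _).mp h).2)
  have hns₂ : (.mk ℂ (b 2) (b.ne_zero 2) : P2) ∉ singularPoints F := fun h =>
    smul_ne_zero hc₂ (hcoord 1)
      (hg₂ ▸ ((mk_mem_singularPoints_iff_gradForm hhom _).mp h).2)
  have honly : ∀ p ∈ singularPoints F, Φ • p = p → p = .mk ℂ (b 0) (b.ne_zero 0) := by
    intro p hp hfix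
    have : p ∈ {p : P2 | Φ • p = p} := hfix
    rw [hfixed] at this
    rcases this with rfl | rfl | h
    exacts [absurd hp hns₁, absurd hp hns₂, h]
  obtain ⟨hfree, horbits⟩ := two_free_orbits hΦ hcard (smul_mem_singularPoints hhom hact hκ)
    fun p hp q hq h h' => (honly p hp h).trans (honly q hq h').symm
  -- The points `P₁`, `P₂`, `P₃` are the classes of `b 1`, `b 2`, `b 0`, in the order of `hfixed`.
  refine ⟨not_exists_pointwise_fixed_line hact hμ hinj, horbits, _, _, _, mk_basis_ne (by decide),
    mk_basis_ne (by decide), mk_basis_ne (by decide), hfixed, (mk_mem_curve hhom _).mpr e₁,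
    (mk_mem_curve hhom _).mpr e₂, fun h => ?_, lineOf (b.coord 1), lineOf (b.coord 2),
    isFixedLine_lineOf_coord hact hμ 1 (hμ0 1), ?_, ?_, ?_,
    isFixedLine_lineOf_coord hact hμ 2 (hμ0 2), ?_, ?_, ?_,
    isTangentAt_lineOf hhom _ e₁ hc₁ (hcoord 2) hg₁, isTangentAt_lineOf hhom _ e₂ hc₂ (hcoord 1) hg₂⟩
  -- If `b 0` were on the curve it would be a singular fixed point, against freeness.
  · have he := (mk_mem_curve hhom _).mp h
    exact hfree _ ((mk_mem_singularPoints_iff_gradForm hhom (b.ne_zero 0)).mpr ⟨he, hP₃ he⟩)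
      ((smul_mk_eq_iff hact (b.ne_zero 0)).mpr ⟨_, hμ 0⟩)
  all_goals rw [mk_mem_lineOf]; simp
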